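/- **Setting.** Let $M$ be a connected smooth manifold of dimension six with an $SU(3)$-structure: a Riemannian metric $\langle\cdot,\cdot\rangle$, an orthogonal almost complex structure $I$, and a complex volume form $\Psi=\psi_++i\psi_-$, that is, a smooth skew-symmetric $3$-form, complex linear in each argument ($\Psi(IX,Y,Z)=i\Psi(X,Y,Z)$), with $|\Psi(e_1,e_2,e_3)|=1$ for every unitary basis $e_1,e_2,e_3$. Let $\omega(X,Y)=\langle X,IY\rangle$ and let $\nabla$ be the Levi-Civita connection. For a one-form $\mu$ put $(I\mu)(X)=-\mu(IX)$. The intrinsic torsion of the structure is $\eta+\xi$, where $\xi_XY=-\tfrac12 I(\nabla_XI)Y$ and $\eta_XY=(I\eta)(X)\,IY$ for the one-form $\eta$ that is determined by the requirement that $\psi_+$ and $\psi_-$ be parallel for the connection $\nabla+\eta+\xi$. The structure is of type $\mathcal W_1^++\mathcal W_1^-+\mathcal W_5$ if $\nabla\omega$ lies at each point in $\mathbb R\psi_++\mathbb R\psi_-$ (where $\psi_\pm$ stands for the tensor $(X,Y,Z)\mapsto\psi_\pm(X,Y,Z)$, to be compared with $(\nabla_X\omega)(Y,Z)$); of type $\mathcal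 W_1^\pm+\mathcal W_5$ if $\nabla\omega$ lies at each point in $\mathbb R\psi_\pm$; of type $\mathcal W_5$ if $\nabla\omega=0$. It is of type $\mathcal W_1^++\mathcal W_1^-$, respectively $\mathcal W_1^\pm$, if it is of type $\mathcal W_1^++\mathcal W_1^-+\mathcal W_5$, respectively $\mathcal W_1^\pm+\mathcal W_5$, and moreover $\eta=0$. **Theorem.** Suppose that $M$ is of type $\mathcal W_1^++\mathcal W_1^-+\mathcal W_5$ and not of type $\mathcal W_5$, and let $w_1^\pm$ be the functions on $M$ with $\nabla\omega=w_1^+\psi_++w_1^-\psi_-$. Then: 1. $\nabla\omega$ is nowhere zero, $\alpha=(w_1^+)^2+(w_1^-)^2$ is a positive constant, and $w_1^\pm$ are differentiable with $dw_1^+=-3w_1^-I\eta$ and $dw_1^-=3w_1^+I\eta$. 2. The one-form $I\eta$ is closed and is given by $3\alpha I\eta=w_1^+dw_1^--w_1^-dw_1^+$. 3. $M$ is of type $\mathcal W_1^++\mathcal W_1^-$ if and only if $w_1^+$ and $w_1^-$ are constant. 4. If $M$ is of type $\mathcal W_1^++\mathcal W_5$, then $M$ is of type $\mathcal W_1^+$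 or of type $\mathcal W_5$. 5. If $M$ is of type $\mathcal W_1^-+\mathcal W_5$, then $M$ is of type $\mathcal W_1^-$ or of type $\mathcal W_5$. -/

import Mathlib

open Bundle Manifold
open scoped Manifold ContDiff

noncomputable section

namespace SU3

/-! ### Tensors of type `(0,k)`, smoothness and covariant derivatives

`M` is a smooth manifold modelled on `E`, of dimension six in the theorem. A `(0,k)`-tensor field is written as a family
`T x : (Fin k → T_x M) → ℝ`; the families used below are all multilinear. -/

section Tensors

variable {E : Type*} [NormedAddCommGroup E] [NormedSpace ℝ E] [FiniteDimensional ℝ E]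
  {M : Type*} [TopologicalSpace M] [ChartedSpace E M] [IsManifold 𝓘(ℝ, E) ∞ M]

/-- The vector field `Y` is smooth at `x`. -/
def SmoothFieldAt (Y : Π x : M, TangentSpace 𝓘(ℝ, E) x) (x : M) : Prop :=
  ContMDiffAt 𝓘(ℝ, E) (𝓘(ℝ, E).prod 𝓘(ℝ, E)) ∞
    (fun y => TotalSpace.mk' E y (Y y)) x

/-- The vector field `Y` is differentiable at `x`. -/
def DiffFieldAt (Y : Π x : M, TangentSpace 𝓘(ℝ, E) x) (x : M) : Prop :=
  MDifferentiableAt 𝓘(ℝ, E) (𝓘(ℝ, E).prod 𝓘(ℝ, E))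
    (fun y => TotalSpace.mk' E y (Y y)) x

/-- A (multilinear) tensor field is smooth iff its value on smooth vector fields is smooth. -/
def IsSmoothTensor {k : ℕ} (T : Π x : M, (Fin k → TangentSpace 𝓘(ℝ, E) x) → ℝ) : Prop :=
  ∀ (x : M) (V : Fin k → Π y : M, TangentSpace 𝓘(ℝ, E) y),
    (∀ i, SmoothFieldAt (V i) x) →
      ContMDiffAt 𝓘(ℝ, E) 𝓘(ℝ, ℝ) ∞ (fun y => T y (fun i => V i y)) x

/-- `J Y` for a field `J` of endomorphisms and a vector field `Y`. -/
def applyField (J : Π x : M, TangentSpace 𝓘(ℝ, E) x →L[ℝ] TangentSpace 𝓘(ℝ, E) x)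
    (Y : Π x : M, TangentSpace 𝓘(ℝ, E) x) : Π x : M, TangentSpace 𝓘(ℝ, E) x :=
  fun x => J x (Y x)

/-- A field of endomorphisms is smooth iff it maps smooth vector fields to smooth ones. -/
def IsSmoothEndo (J : Π x : M, TangentSpace 𝓘(ℝ, E) x →L[ℝ] TangentSpace 𝓘(ℝ, E) x) : Prop :=
  ∀ (x : M) (Y : Π y : M, TangentSpace 𝓘(ℝ, E) y),
    SmoothFieldAt Y x → SmoothFieldAt (applyField J Y) x

/-- The covariant derivative of a `(0,k)`-tensor field `T` with respect to `D`, where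
`D Y x u` stands for `D_u Y` at `x`:
`(D_u T)(V₁,…,V_k) = u(T(V₁,…,V_k)) - ∑ᵢ T(V₁,…,D_u Vᵢ,…,V_k)`. -/
def covDeriv {k : ℕ}
    (D : (Π x : M, TangentSpace 𝓘(ℝ, E) x) →
      Π x : M, TangentSpace 𝓘(ℝ, E) x → TangentSpace 𝓘(ℝ, E) x)
    (T : Π x : M, (Fin k → TangentSpace 𝓘(ℝ, E) x) → ℝ)
    (V : Fin k → Π x : M, TangentSpace 𝓘(ℝ, E) x) (x : M) (u : TangentSpace 𝓘(ℝ, E) x) : ℝ :=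
  mvfderiv 𝓘(ℝ, E) (fun y => T y (fun i => V i y)) x u
    - ∑ i, T x (Function.update (fun j => V j x) i (D (V i) x u))

/-- A tensor field is parallel with respect to `D`. -/
def IsParallel {k : ℕ}
    (D : (Π x : M, TangentSpace 𝓘(ℝ, E) x) →
      Π x : M, TangentSpace 𝓘(ℝ, E) x → TangentSpace 𝓘(ℝ, E) x)
    (T : Π x : M, (Fin k → TangentSpace 𝓘(ℝ, E) x) → ℝ) : Prop :=
  ∀ (x : M) (V : Fin k → Π y : M, TangentSpace 𝓘(ℝ, E) y), (∀ i, DiffFieldAt (V i) x) →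
    ∀ u : TangentSpace 𝓘(ℝ, E) x, covDeriv D T V x u = 0

/-- A one-form is closed if it is smooth and `dθ = 0`, where
`dθ(X,Y) = X(θ(Y)) - Y(θ(X)) - θ([X,Y])`. -/
def IsClosedOneForm (θ : Π x : M, TangentSpace 𝓘(ℝ, E) x →L[ℝ] ℝ) : Prop :=
  IsSmoothTensor (k := 1) (fun x v => θ x (v 0)) ∧
    ∀ (x : M) (X Y : Π y : M, TangentSpace 𝓘(ℝ, E) y), DiffFieldAt X x → DiffFieldAt Y x →
      mvfderiv 𝓘(ℝ, E) (fun y => θ y (Y y)) x (X x)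
        - mvfderiv 𝓘(ℝ, E) (fun y => θ y (X y)) x (Y x)
        - θ x (VectorField.mlieBracket 𝓘(ℝ, E) X Y x) = 0

end Tensors

/-! ### Special almost Hermitian six-manifolds -/

section Structures

variable (E : Type*) [NormedAddCommGroup E] [NormedSpace ℝ E] [FiniteDimensional ℝ E]
  (M : Type*) [TopologicalSpace M] [ChartedSpace E M] [IsManifold 𝓘(ℝ, E) ∞ M]
  [RiemannianBundle (fun x : M => TangentSpace 𝓘(ℝ, E) x)]
  [IsContMDiffRiemannianBundle 𝓘(ℝ, E) ∞ E (fun x : M => TangentSpace 𝓘(ℝ, E) x)]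

/-- An `SU(3)`-structure on the Riemannian six-manifold `M`, compatible with its metric:
an orthogonal almost complex structure `J` and a complex volume form `Ψ` with `⟨Ψ,Ψ⟩_ℂ = 1`. -/
structure SpecialAlmostHermitian where
  /-- the almost complex structure -/
  J : Π x : M, TangentSpace 𝓘(ℝ, E) x →L[ℝ] TangentSpace 𝓘(ℝ, E) x
  J_smooth : IsSmoothEndo J
  J_sq : ∀ (x : M) (u : TangentSpace 𝓘(ℝ, E) x), J x (J x u) = -u
  J_orthogonal : ∀ (x : M) (u v : TangentSpace 𝓘(ℝ, E) x),
    inner ℝ (J x u) (J x v) = inner ℝ u v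
  /-- the complex volume form: a skew-symmetric form that is complex linear in each argument -/
  Ψ : Π x : M, TangentSpace 𝓘(ℝ, E) x [⋀^Fin 3]→L[ℝ] ℂ
  Ψ_re_smooth : IsSmoothTensor (fun x v => (Ψ x v).re)
  Ψ_im_smooth : IsSmoothTensor (fun x v => (Ψ x v).im)
  Ψ_complex : ∀ (x : M) (v : Fin 3 → TangentSpace 𝓘(ℝ, E) x) (i : Fin 3),
    Ψ x (Function.update v i (J x (v i))) = Complex.I * Ψ x v
  /-- `⟨Ψ,Ψ⟩_ℂ = 1`, that is, `|Ψ(e₁,e₂,e₃)| = 1` for each unitary basis `e₁, e₂, e₃` of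
  `T_x M` as a complex vector space with the Hermitian product `⟨u,v⟩ + i⟨u,Jv⟩`. -/
  Ψ_unit : ∀ (x : M) (e : Fin 3 → TangentSpace 𝓘(ℝ, E) x),
    (∀ i j, inner ℝ (e i) (e j) = if i = j then (1 : ℝ) else 0) →
    (∀ i j, inner ℝ (e i) (J x (e j)) = (0 : ℝ)) → ‖Ψ x e‖ = 1

variable {E M}

/-- `cov` is the Levi-Civita connection: `u⟨Y,Z⟩ = ⟨∇_u Y,Z⟩ + ⟨Y,∇_u Z⟩`, and its torsion
vanishes. -/
def IsLeviCivita
    (cov : CovariantDerivative 𝓘(ℝ, E) E (fun x : M => TangentSpace 𝓘(ℝ, E) x)) : Prop :=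
  IsParallel (fun Y x u => cov Y x u)
      (fun (x : M) (v : Fin 2 → TangentSpace 𝓘(ℝ, E) x) => (inner ℝ (v 0) (v 1) : ℝ)) ∧
    cov.torsion = 0

namespace SpecialAlmostHermitian

variable (S : SpecialAlmostHermitian E M)
  (cov : CovariantDerivative 𝓘(ℝ, E) E (fun x : M => TangentSpace 𝓘(ℝ, E) x))

/-- The Kähler form `ω(u,v) = ⟨u, Jv⟩`. -/
def omega (x : M) (v : Fin 2 → TangentSpace 𝓘(ℝ, E) x) : ℝ := inner ℝ (v 0) (S.J x (v 1))

/-- `ψ₊`, the real part of `Ψ`. -/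
def psiPlus (x : M) (v : Fin 3 → TangentSpace 𝓘(ℝ, E) x) : ℝ := (S.Ψ x v).re

/-- `ψ₋`, the imaginary part of `Ψ`. -/
def psiMinus (x : M) (v : Fin 3 → TangentSpace 𝓘(ℝ, E) x) : ℝ := (S.Ψ x v).im

/-- The one-form `Iη`, that is, `(Iη)(u) = -η(Ju)`. -/
def I (η : Π x : M, TangentSpace 𝓘(ℝ, E) x →L[ℝ] ℝ) (x : M) : TangentSpace 𝓘(ℝ, E) x →L[ℝ] ℝ :=
  -((η x).comp (S.J x))

/-- The `U(3)`-part of the intrinsic torsion, `ξ_u Y = -½ J (∇_u J) Y`, where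
`(∇_u J) Y = ∇_u (JY) - J (∇_u Y)`. -/
def xi (Y : Π x : M, TangentSpace 𝓘(ℝ, E) x) (x : M) (u : TangentSpace 𝓘(ℝ, E) x) :
    TangentSpace 𝓘(ℝ, E) x :=
  -((1 / 2 : ℝ) • S.J x (cov (applyField S.J Y) x u - S.J x (cov Y x u)))

/-- The metric connection `∇ + η + ξ`, where `η_u Y = (Iη)(u) JY`. It preserves `J` (because of
the choice of `ξ`), `ξ_u` is orthogonal to `𝔲(3)`, and `η_u` spans the orthogonal complement of
`𝔰𝔲(3)` in `𝔲(3)`. -/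
def connection (η : Π x : M, TangentSpace 𝓘(ℝ, E) x →L[ℝ] ℝ)
    (Y : Π x : M, TangentSpace 𝓘(ℝ, E) x) (x : M) (u : TangentSpace 𝓘(ℝ, E) x) :
    TangentSpace 𝓘(ℝ, E) x :=
  cov Y x u + S.I η x u • S.J x (Y x) + S.xi cov Y x u

/-- `η` is the one-form of the `W₅`-part of the intrinsic `SU(3)`-torsion `η + ξ`: the connection
`∇ + η + ξ` is the minimal `SU(3)`-connection, that is, `ψ₊` and `ψ₋` are parallel for it
(the metric and `ω` always are). -/
def IsTorsionOneForm (η : Π x : M, TangentSpace 𝓘(ℝ, E) x →L[ℝ] ℝ) : Prop :=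
  IsParallel (S.connection cov η) S.psiPlus ∧ IsParallel (S.connection cov η) S.psiMinus

/-- `∇ω = a ψ₊ + b ψ₋` at the point `x`, that is,
`(∇_u ω)(Y,Z) = a ψ₊(u,Y,Z) + b ψ₋(u,Y,Z)`. -/
def NablaOmegaEqAt (x : M) (a b : ℝ) : Prop :=
  ∀ V : Fin 2 → Π y : M, TangentSpace 𝓘(ℝ, E) y, (∀ i, DiffFieldAt (V i) x) →
    ∀ u : TangentSpace 𝓘(ℝ, E) x,
      covDeriv (fun Y x u => cov Y x u) S.omega V x u =
        a * S.psiPlus x ![u, V 0 x, V 1 x] + b * S.psiMinus x ![u, V 0 x, V 1 x]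

/-- Type `W₁⁺ + W₁⁻ + W₅`: at each point `∇ω` lies in `ℝψ₊ + ℝψ₋`, no condition on `η`. -/
def IsTypeW1PlusW1MinusW5 : Prop := ∀ x : M, ∃ a b : ℝ, S.NablaOmegaEqAt cov x a b

/-- Type `W₁⁺ + W₅`: at each point `∇ω` lies in `ℝψ₊`, no condition on `η`. -/
def IsTypeW1PlusW5 : Prop := ∀ x : M, ∃ a : ℝ, S.NablaOmegaEqAt cov x a 0

/-- Type `W₁⁻ + W₅`: at each point `∇ω` lies in `ℝψ₋`, no condition on `η`. -/
def IsTypeW1MinusW5 : Prop := ∀ x : M, ∃ b : ℝ, S.NablaOmegaEqAt cov x 0 b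

/-- Type `W₅`: `∇ω = 0`, no condition on `η`. -/
def IsTypeW5 : Prop := ∀ x : M, S.NablaOmegaEqAt cov x 0 0

/-- Type `W₁⁺ + W₁⁻`: at each point `∇ω` lies in `ℝψ₊ + ℝψ₋`, and `η = 0`. -/
def IsTypeW1PlusW1Minus (η : Π x : M, TangentSpace 𝓘(ℝ, E) x →L[ℝ] ℝ) : Prop :=
  S.IsTypeW1PlusW1MinusW5 cov ∧ ∀ x, η x = 0

/-- Type `W₁⁺`: at each point `∇ω` lies in `ℝψ₊`, and `η = 0`. -/
def IsTypeW1Plus (η : Π x : M, TangentSpace 𝓘(ℝ, E) x →L[ℝ] ℝ) : Prop :=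
  S.IsTypeW1PlusW5 cov ∧ ∀ x, η x = 0

/-- Type `W₁⁻`: at each point `∇ω` lies in `ℝψ₋`, and `η = 0`. -/
def IsTypeW1Minus (η : Π x : M, TangentSpace 𝓘(ℝ, E) x →L[ℝ] ℝ) : Prop :=
  S.IsTypeW1MinusW5 cov ∧ ∀ x, η x = 0

end SpecialAlmostHermitian

end Structures

end SU3

end

set_option linter.unusedSectionVars false

/-! Put W = w₊ + i w₋, so that ∇ω = Re(W̄Ψ) and α = |W|². Since ∇ is torsion-free, alternation gives
dω = 3 Re(W̄Ψ) (`d_omega`), so Re(W̄Ψ) is closed. On the other hand Ψ is parallel for ∇ + η + ξ, and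
ξ is itself expressed through W and Ψ (`psi_xi`). Alternating the resulting formula for ∇Ψ
(`alternate_derivΨ`) yields d(W̄Ψ) = β∧Ψ + 2iα ω∧ω with β = dW̄ + 3i W̄ Iη (`d_reW_imW`).

The real part says Re(β∧Ψ) = 0, which forces β to be of type (1,0) (`beta_J`). Then β∧Ψ is a
(4,0)-form in complex dimension three and vanishes, leaving d Im(W̄Ψ) = 2α ω∧ω (`d_imW`). One more
exterior derivative gives 0 = dα∧ω∧ω + 2α dω∧ω, where dω∧ω = 0 by type; hence dα = 0
(`mvfderiv_alpha`), and α is constant by connectedness. Finally Wβ is of type (1,0) with real part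
½dα = 0, so β = 0 wherever α ≠ 0 (`beta_eq_zero`). This is the pair of equations for dw₊ and dw₋;
the remaining assertions follow from it by algebra and by the uniqueness of the coefficients of ∇ω.

Forms are handled through their components on coordinate fields. These commute, so exterior
derivatives are alternating sums of directional derivatives, d² = 0 is the symmetry of second
derivatives, and vanishing torsion is a symmetry of the covariant derivatives of the fields.
Smoothness of w₊ and w₋ is not assumed but read off from dω (`contMDiffAt_coeff`). -/

namespace SU3
open VectorField Filter Topology

/-! ### Calculus on manifolds: coordinate fields, brackets and second derivatives -/

section Calculus

variable {E : Type*} [NormedAddCommGroup E] [NormedSpace ℝ E] [FiniteDimensional ℝ E]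
  {M : Type*} [TopologicalSpace M] [ChartedSpace E M] [IsManifold 𝓘(ℝ, E) ∞ M]

theorem SmoothFieldAt.diffFieldAt {X : Π y : M, TangentSpace 𝓘(ℝ, E) y} {x : M}
    (h : SmoothFieldAt X x) : DiffFieldAt X x :=
  ContMDiffAt.mdifferentiableAt h (by simp)

/-- The vector field on the domain of the chart at `x₀` with constant coordinates `v`. -/
noncomputable def chartField (x₀ : M) (v : E) : Π y : M, TangentSpace 𝓘(ℝ, E) y :=
  mpullback 𝓘(ℝ, E) 𝓘(ℝ, E) (extChartAt 𝓘(ℝ, E) x₀) (fun _ => v)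

theorem two_le_infty : (2 : ℕ∞ω) ≤ ∞ := by
  exact WithTop.coe_le_coe.2 (le_top : (2 : ℕ∞) ≤ ⊤)

theorem chartField_smooth (x₀ : M) (v : E) {y : M} (hy : y ∈ (extChartAt 𝓘(ℝ, E) x₀).source) :
    SmoothFieldAt (chartField x₀ v) y := by
  have hI : IsManifold 𝓘(ℝ, E) 1 M := IsManifold.of_le (n := ∞) (by simp)
  have : CompleteSpace E := FiniteDimensional.complete ℝ E
  have h := ContMDiffWithinAt.mpullback_vectorField_preimage (n := ∞) (m := ∞)
    (f := extChartAt 𝓘(ℝ, E) x₀) (V := fun _ => v) (t := Set.univ) (x₀ := y)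
    (contMDiffWithinAt_univ.2 (contMDiffAt_vectorSpace_iff_contDiffAt.2 contDiffAt_const))
    (contMDiffAt_extChartAt' (by simpa using hy)) (isInvertible_mfderiv_extChartAt hy) (by simp)
  exact contMDiffWithinAt_univ.1 h

/-- Brackets commute with pullback along the chart, and constant fields on `E` commute. This removes
every bracket term from the exterior derivatives computed later. -/
theorem chartField_bracket (x₀ : M) (v w : E) {y : M}
    (hy : y ∈ (extChartAt 𝓘(ℝ, E) x₀).source) :
    mlieBracket 𝓘(ℝ, E) (chartField x₀ v) (chartField x₀ w) y = 0 := by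
  have hI : IsManifold 𝓘(ℝ, E) 1 M := IsManifold.of_le (n := ∞) (by simp)
  have hI : IsManifold 𝓘(ℝ, E) (minSmoothness ℝ 2) M :=
    IsManifold.of_le (n := ∞) (by simpa using two_le_infty)
  have : CompleteSpace E := FiniteDimensional.complete ℝ E
  have h := mpullback_mlieBracket (I := 𝓘(ℝ, E)) (I' := 𝓘(ℝ, E)) (n := ∞)
    (f := extChartAt 𝓘(ℝ, E) x₀) (x₀ := y) (V := fun _ => v) (W := fun _ => w)
    (ContMDiffAt.mdifferentiableAt (n := 1)
      (contMDiffAt_vectorSpace_iff_contDiffAt.2 contDiffAt_const) (by simp))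
    (ContMDiffAt.mdifferentiableAt (n := 1)
      (contMDiffAt_vectorSpace_iff_contDiffAt.2 contDiffAt_const) (by simp))
    (contMDiffAt_extChartAt' (by simpa using hy)) (by simpa using two_le_infty)
  have h0 : ∀ z : E, mlieBracket 𝓘(ℝ, E) (fun _ : E => v) (fun _ : E => w) z = (0 : E) := by
    intro z
    refine (congrFun mlieBracketWithin_univ z).symm.trans ?_
    exact (congrFun mlieBracketWithin_eq_lieBracketWithin z).trans
      (by simp [lieBracketWithin] :
        lieBracketWithin ℝ (fun _ : E => v) (fun _ : E => w) Set.univ z = 0)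
  refine h.symm.trans ?_
  refine (congrArg (mfderiv 𝓘(ℝ, E) 𝓘(ℝ, E) (extChartAt 𝓘(ℝ, E) x₀) y).inverse (h0 _)).trans ?_
  exact map_zero _

/-- The derivative of the chart at its own base point is the identity of `E`. Hence each tangent
vector extends to a coordinate field, and tensor identities need only be checked on such fields. -/
theorem chartField_self (x : M) (u : TangentSpace 𝓘(ℝ, E) x) :
    chartField (E := E) x u x = u := by
  have hI : IsManifold 𝓘(ℝ, E) 1 M := IsManifold.of_le (n := ∞) (by simp)
  refine (congrArg (fun L : E →L[ℝ] E => L.inverse u) mfderiv_extChartAt_self).trans ?_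
  exact congrArg (fun L : E →L[ℝ] E => L u) ContinuousLinearMap.inverse_id

/-- The coordinate expression of a vector field in the chart at `x`. -/
noncomputable def chartRep (x : M) (X : Π y : M, TangentSpace 𝓘(ℝ, E) y) (z : E) : E :=
  mfderiv 𝓘(ℝ, E) 𝓘(ℝ, E) (extChartAt 𝓘(ℝ, E) x) ((extChartAt 𝓘(ℝ, E) x).symm z)
    (X ((extChartAt 𝓘(ℝ, E) x).symm z))

theorem chartRep_self (x : M) (X : Π y : M, TangentSpace 𝓘(ℝ, E) y) :
    chartRep x X (extChartAt 𝓘(ℝ, E) x x) = X x := by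
  have hI : IsManifold 𝓘(ℝ, E) 1 M := IsManifold.of_le (n := ∞) (by simp)
  have h : ∀ y, y = x → mfderiv 𝓘(ℝ, E) 𝓘(ℝ, E) (extChartAt 𝓘(ℝ, E) x) y (X y) = X x := by
    rintro y rfl
    rw [mfderiv_extChartAt_self]
    rfl
  exact h _ (extChartAt_to_inv x)

/-- Regularity of a field is defined through the trivialization of the tangent bundle; this
transfers it to the coordinate expression. -/
theorem trivialization_snd_eventuallyEq (x : M) (X : Π y : M, TangentSpace 𝓘(ℝ, E) y) :
    (fun y => (trivializationAt E (TangentSpace 𝓘(ℝ, E)) x ⟨y, X y⟩).2) =ᶠ[𝓝 x]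
      fun y => chartRep x X (extChartAt 𝓘(ℝ, E) x y) := by
  have hI : IsManifold 𝓘(ℝ, E) 1 M := IsManifold.of_le (n := ∞) (by simp)
  filter_upwards [extChartAt_source_mem_nhds (I := 𝓘(ℝ, E)) x] with y hy
  rw [chartRep, (extChartAt 𝓘(ℝ, E) x).left_inv hy]
  rw [extChartAt_source] at hy
  rw [← TangentBundle.continuousLinearMapAt_trivializationAt hy]
  exact (Trivialization.continuousLinearMapAt_apply_of_mem ℝ _ (by simpa using hy) _).symm

theorem contDiffAt_of_comp_extChartAt {g : E → E} {x : M}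
    (h : ContMDiffAt 𝓘(ℝ, E) 𝓘(ℝ, E) ∞ (fun y => g (extChartAt 𝓘(ℝ, E) x y)) x) :
    ContDiffAt ℝ ∞ g (extChartAt 𝓘(ℝ, E) x x) := by
  have h1 := (contMDiffAt_iff.1 h).2
  simp only [modelWithCornersSelf_coe, Set.range_id] at h1
  refine (contDiffWithinAt_univ.1 h1).congr_of_eventuallyEq ?_
  filter_upwards [extChartAt_target_mem_nhds (I := 𝓘(ℝ, E)) x] with z hz
  have := (extChartAt 𝓘(ℝ, E) x).right_inv hz
  simp only [extChartAt_model_space_eq_id, PartialEquiv.refl_coe, Function.comp_apply, id, this]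

theorem differentiableAt_of_comp_extChartAt {g : E → E} {x : M}
    (h : MDifferentiableAt 𝓘(ℝ, E) 𝓘(ℝ, E) (fun y => g (extChartAt 𝓘(ℝ, E) x y)) x) :
    DifferentiableAt ℝ g (extChartAt 𝓘(ℝ, E) x x) := by
  have h1 := ((mdifferentiableAt_iff _ _).1 h).2
  simp only [modelWithCornersSelf_coe, Set.range_id] at h1
  refine (differentiableWithinAt_univ.1 h1).congr_of_eventuallyEq ?_
  filter_upwards [extChartAt_target_mem_nhds (I := 𝓘(ℝ, E)) x] with z hz
  have := (extChartAt 𝓘(ℝ, E) x).right_inv hz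
  simp only [writtenInExtChartAt, extChartAt_model_space_eq_id, PartialEquiv.refl_coe,
    Function.comp_apply, id, this]

theorem SmoothFieldAt.chartRep {X : Π y : M, TangentSpace 𝓘(ℝ, E) y} {x : M}
    (h : SmoothFieldAt X x) : ContDiffAt ℝ ∞ (chartRep x X) (extChartAt 𝓘(ℝ, E) x x) :=
  contDiffAt_of_comp_extChartAt <|
    ((contMDiffAt_totalSpace.1 h).2).congr_of_eventuallyEq (trivialization_snd_eventuallyEq x X).symm

theorem DiffFieldAt.chartRep {X : Π y : M, TangentSpace 𝓘(ℝ, E) y} {x : M}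
    (h : DiffFieldAt X x) : DifferentiableAt ℝ (chartRep x X) (extChartAt 𝓘(ℝ, E) x x) :=
  differentiableAt_of_comp_extChartAt <|
    ((mdifferentiableAt_totalSpace _ _).1 h).2.congr_of_eventuallyEq
      (trivialization_snd_eventuallyEq x X).symm

theorem mvfderiv_eq_fderiv {f : M → ℝ} {x : M} (hf : MDifferentiableAt 𝓘(ℝ, E) 𝓘(ℝ, ℝ) f x)
    (u : TangentSpace 𝓘(ℝ, E) x) :
    mvfderiv 𝓘(ℝ, E) f x u =
      fderiv ℝ (f ∘ (extChartAt 𝓘(ℝ, E) x).symm) (extChartAt 𝓘(ℝ, E) x x) u := by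
  rw [MDifferentiableAt.mvfderiv hf]
  simp [writtenInExtChartAt]
  rfl

theorem contDiffAt_chart {f : M → ℝ} {x : M} (hf : ContMDiffAt 𝓘(ℝ, E) 𝓘(ℝ, ℝ) ∞ f x) :
    ContDiffAt ℝ ∞ (f ∘ (extChartAt 𝓘(ℝ, E) x).symm) (extChartAt 𝓘(ℝ, E) x x) := by
  have h1 := (contMDiffAt_iff.1 hf).2
  simp only [modelWithCornersSelf_coe, Set.range_id] at h1
  exact contDiffWithinAt_univ.1 h1

/-- The identity is needed on a neighbourhood, with the chart at `x` kept fixed, because both sides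
are differentiated again. -/
theorem mvfderiv_field_eq {f : M → ℝ} {x : M} (hf : ContMDiffAt 𝓘(ℝ, E) 𝓘(ℝ, ℝ) ∞ f x)
    (X : Π y : M, TangentSpace 𝓘(ℝ, E) y) :
    ∀ᶠ y in 𝓝 x, mvfderiv 𝓘(ℝ, E) f y (X y) =
        fderiv ℝ (f ∘ (extChartAt 𝓘(ℝ, E) x).symm) (extChartAt 𝓘(ℝ, E) x y)
          (chartRep x X (extChartAt 𝓘(ℝ, E) x y)) := by
  have hI : IsManifold 𝓘(ℝ, E) 1 M := IsManifold.of_le (n := ∞) (by simp)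
  have h1 : ∀ᶠ z in 𝓝 (extChartAt 𝓘(ℝ, E) x x),
      DifferentiableAt ℝ (f ∘ (extChartAt 𝓘(ℝ, E) x).symm) z := by
    have := ((contDiffAt_chart hf).of_le (m := 1) (by simp)).eventually (by simp)
    exact this.mono fun z hz => hz.differentiableAt (by simp)
  filter_upwards [(continuousAt_extChartAt (I := 𝓘(ℝ, E)) x).eventually h1,
    (isOpen_extChartAt_source (I := 𝓘(ℝ, E)) x).mem_nhds (mem_extChartAt_source x)] with y hy hys
  have hl := (extChartAt 𝓘(ℝ, E) x).left_inv hys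
  rw [chartRep, hl]
  have he : f =ᶠ[𝓝 y] (f ∘ (extChartAt 𝓘(ℝ, E) x).symm) ∘ extChartAt 𝓘(ℝ, E) x := by
    filter_upwards [(isOpen_extChartAt_source (I := 𝓘(ℝ, E)) x).mem_nhds hys] with w hw
    simp only [Function.comp_apply, (extChartAt 𝓘(ℝ, E) x).left_inv hw]
  have h2 : mvfderiv 𝓘(ℝ, E) f y =
      mvfderiv 𝓘(ℝ, E) ((f ∘ (extChartAt 𝓘(ℝ, E) x).symm) ∘ extChartAt 𝓘(ℝ, E) x) y := by
    unfold mvfderiv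
    rw [he.mfderiv_eq]
    rfl
  rw [h2, mvfderiv_comp_apply y hy.mdifferentiableAt
    (mdifferentiableAt_extChartAt (by simpa using hys))]
  unfold mvfderiv
  rw [mfderiv_eq_fderiv]
  rfl

theorem contMDiffAt_mvfderiv {f : M → ℝ} {x : M} (hf : ContMDiffAt 𝓘(ℝ, E) 𝓘(ℝ, ℝ) ∞ f x)
    {X : Π y : M, TangentSpace 𝓘(ℝ, E) y} (hX : SmoothFieldAt X x) :
    ContMDiffAt 𝓘(ℝ, E) 𝓘(ℝ, ℝ) ∞ (fun y => mvfderiv 𝓘(ℝ, E) f y (X y)) x := by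
  have h1 : ContDiffAt ℝ ∞ (fun z => fderiv ℝ (f ∘ (extChartAt 𝓘(ℝ, E) x).symm) z
      (chartRep x X z)) (extChartAt 𝓘(ℝ, E) x x) :=
    ((contDiffAt_chart hf).fderiv_right (m := ∞) (by simp)).clm_apply hX.chartRep
  exact (h1.contMDiffAt.comp x contMDiffAt_extChartAt).congr_of_eventuallyEq
    (mvfderiv_field_eq hf X)

theorem mdifferentiableAt_mvfderiv {f : M → ℝ} {x : M}
    (hf : ContMDiffAt 𝓘(ℝ, E) 𝓘(ℝ, ℝ) ∞ f x)
    {Y : Π y : M, TangentSpace 𝓘(ℝ, E) y} (hY : DiffFieldAt Y x) :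
    MDifferentiableAt 𝓘(ℝ, E) 𝓘(ℝ, ℝ) (fun y => mvfderiv 𝓘(ℝ, E) f y (Y y)) x := by
  have hI : IsManifold 𝓘(ℝ, E) 1 M := IsManifold.of_le (n := ∞) (by simp)
  have hd : DifferentiableAt ℝ (fderiv ℝ (f ∘ (extChartAt 𝓘(ℝ, E) x).symm))
      (extChartAt 𝓘(ℝ, E) x x) :=
    ((contDiffAt_chart hf).fderiv_right (m := 1) two_le_infty).differentiableAt
      (by simp)
  exact ((hd.clm_apply hY.chartRep).mdifferentiableAt.comp x
    (mdifferentiableAt_extChartAt (mem_chart_source E x))).congr_of_eventuallyEq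
    (mvfderiv_field_eq hf Y)

/-- The product rule in the chart. The first term is the symmetric Hessian; the second, after
antisymmetrization, produces the bracket. -/
theorem mvfderiv_mvfderiv {f : M → ℝ} {x : M} (hf : ContMDiffAt 𝓘(ℝ, E) 𝓘(ℝ, ℝ) ∞ f x)
    {Y : Π y : M, TangentSpace 𝓘(ℝ, E) y} (hY : DiffFieldAt Y x)
    (u : TangentSpace 𝓘(ℝ, E) x) :
    mvfderiv 𝓘(ℝ, E) (fun y => mvfderiv 𝓘(ℝ, E) f y (Y y)) x u =
      fderiv ℝ (fderiv ℝ (f ∘ (extChartAt 𝓘(ℝ, E) x).symm)) (extChartAt 𝓘(ℝ, E) x x) u (Y x) +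
      fderiv ℝ (f ∘ (extChartAt 𝓘(ℝ, E) x).symm) (extChartAt 𝓘(ℝ, E) x x)
        (fderiv ℝ (chartRep x Y) (extChartAt 𝓘(ℝ, E) x x) u) := by
  have hI : IsManifold 𝓘(ℝ, E) 1 M := IsManifold.of_le (n := ∞) (by simp)
  have hd : DifferentiableAt ℝ (fderiv ℝ (f ∘ (extChartAt 𝓘(ℝ, E) x).symm))
      (extChartAt 𝓘(ℝ, E) x x) :=
    ((contDiffAt_chart hf).fderiv_right (m := 1) two_le_infty).differentiableAt
      (by simp)
  have h1 := hd.hasFDerivAt.clm_apply hY.chartRep.hasFDerivAt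
  have he := mvfderiv_field_eq hf Y
  have h2 := mdifferentiableAt_mvfderiv hf hY
  have h3 : (fun y => mvfderiv 𝓘(ℝ, E) f y (Y y)) ∘ (extChartAt 𝓘(ℝ, E) x).symm
      =ᶠ[𝓝 (extChartAt 𝓘(ℝ, E) x x)] fun z => fderiv ℝ (f ∘ (extChartAt 𝓘(ℝ, E) x).symm) z
      (chartRep x Y z) := by
    have hc := continuousAt_extChartAt_symm (I := 𝓘(ℝ, E)) x
    rw [ContinuousAt, extChartAt_to_inv] at hc
    filter_upwards [hc.eventually he, extChartAt_target_mem_nhds (I := 𝓘(ℝ, E)) x] with z hz hzt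
    rw [(extChartAt 𝓘(ℝ, E) x).right_inv hzt] at hz
    exact hz
  rw [mvfderiv_eq_fderiv h2, h3.fderiv_eq, h1.fderiv, chartRep_self]
  exact add_comm _ _

theorem mlieBracket_eq_chart (x : M) (X Y : Π y : M, TangentSpace 𝓘(ℝ, E) y) :
    mlieBracket 𝓘(ℝ, E) X Y x =
      fderiv ℝ (chartRep x Y) (extChartAt 𝓘(ℝ, E) x x) (X x) -
        fderiv ℝ (chartRep x X) (extChartAt 𝓘(ℝ, E) x x) (Y x) := by
  have hI : IsManifold 𝓘(ℝ, E) 1 M := IsManifold.of_le (n := ∞) (by simp)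
  have key : ∀ X : Π y : M, TangentSpace 𝓘(ℝ, E) y,
      (mpullbackWithin 𝓘(ℝ, E) 𝓘(ℝ, E) (extChartAt 𝓘(ℝ, E) x).symm X (Set.range 𝓘(ℝ, E)) : E → E)
        =ᶠ[𝓝 (extChartAt 𝓘(ℝ, E) x x)] chartRep x X := by
    intro X
    filter_upwards [extChartAt_target_mem_nhds (I := 𝓘(ℝ, E)) x] with z hz
    rw [mpullbackWithin_apply, chartRep]
    congr 1
    exact ContinuousLinearMap.inverse_eq
      (mfderivWithin_extChartAt_symm_comp_mfderiv_extChartAt hz)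
      (mfderiv_extChartAt_comp_mfderivWithin_extChartAt_symm hz)
  rw [← mlieBracketWithin_univ, mlieBracketWithin_apply, mfderiv_extChartAt_self]
  refine (congrArg (fun L : E →L[ℝ] E => L _) ContinuousLinearMap.inverse_id).trans ?_
  have h : lieBracketWithin ℝ
      (mpullbackWithin 𝓘(ℝ, E) 𝓘(ℝ, E) (extChartAt 𝓘(ℝ, E) x).symm X (Set.range 𝓘(ℝ, E)) : E → E)
      (mpullbackWithin 𝓘(ℝ, E) 𝓘(ℝ, E) (extChartAt 𝓘(ℝ, E) x).symm Y (Set.range 𝓘(ℝ, E)) : E → E)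
      ((extChartAt 𝓘(ℝ, E) x).symm ⁻¹' Set.univ ∩ Set.range 𝓘(ℝ, E)) (extChartAt 𝓘(ℝ, E) x x) =
      lieBracket ℝ (chartRep x X) (chartRep x Y) (extChartAt 𝓘(ℝ, E) x x) := by
    rw [show (extChartAt 𝓘(ℝ, E) x).symm ⁻¹' Set.univ ∩ Set.range 𝓘(ℝ, E) = Set.univ by simp]
    refine (congrFun (lieBracketWithin_univ (𝕜 := ℝ)) _).trans ?_
    exact (key X).lieBracket_vectorField_eq (key Y)
  refine Eq.trans h ?_
  rw [lieBracket, chartRep_self, chartRep_self]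

/-- `X(Yf) - Y(Xf) = [X,Y]f`. -/
theorem mvfderiv_mvfderiv_sub {f : M → ℝ} {x : M} (hf : ContMDiffAt 𝓘(ℝ, E) 𝓘(ℝ, ℝ) ∞ f x)
    {X Y : Π y : M, TangentSpace 𝓘(ℝ, E) y} (hX : DiffFieldAt X x) (hY : DiffFieldAt Y x) :
    mvfderiv 𝓘(ℝ, E) (fun y => mvfderiv 𝓘(ℝ, E) f y (Y y)) x (X x)
      - mvfderiv 𝓘(ℝ, E) (fun y => mvfderiv 𝓘(ℝ, E) f y (X y)) x (Y x)
      = mvfderiv 𝓘(ℝ, E) f x (mlieBracket 𝓘(ℝ, E) X Y x) := by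
  have hs : IsSymmSndFDerivAt ℝ (f ∘ (extChartAt 𝓘(ℝ, E) x).symm) (extChartAt 𝓘(ℝ, E) x x) :=
    (contDiffAt_chart hf).isSymmSndFDerivAt (by simpa using two_le_infty)
  rw [mvfderiv_mvfderiv hf hY, mvfderiv_mvfderiv hf hX,
    mvfderiv_eq_fderiv (hf.mdifferentiableAt (by simp)), mlieBracket_eq_chart, map_sub,
    hs.eq (X x) (Y x)]
  ring

/-- On a ball in the chart the mean value inequality applies by convexity, so `f` is locally
constant; connectedness does the rest. -/
theorem eq_of_mvfderiv_eq_zero [ConnectedSpace M] {f : M → ℝ}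
    (hf : ∀ x, MDifferentiableAt 𝓘(ℝ, E) 𝓘(ℝ, ℝ) f x) (h0 : ∀ x, mvfderiv 𝓘(ℝ, E) f x = 0)
    (x y : M) : f x = f y := by
  have hI : IsManifold 𝓘(ℝ, E) 1 M := IsManifold.of_le (n := ∞) (by simp)
  suffices h : IsLocallyConstant f from h.apply_eq_of_preconnectedSpace _ _
  rw [IsLocallyConstant.iff_eventually_eq]
  intro x
  obtain ⟨r, hr, hb⟩ := Metric.mem_nhds_iff.1 (extChartAt_target_mem_nhds (I := 𝓘(ℝ, E)) x)
  have hd : ∀ z ∈ Metric.ball (extChartAt 𝓘(ℝ, E) x x) r,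
      HasFDerivAt (f ∘ (extChartAt 𝓘(ℝ, E) x).symm) (0 : E →L[ℝ] ℝ) z := by
    intro z hz
    have hs : MDifferentiableAt 𝓘(ℝ, E) 𝓘(ℝ, E) (extChartAt 𝓘(ℝ, E) x).symm z := by
      have := mdifferentiableWithinAt_extChartAt_symm (I := 𝓘(ℝ, E)) (hb hz)
      simpa [mdifferentiableWithinAt_univ] using this
    have hc := (hf _).comp z hs
    have : fderiv ℝ (f ∘ (extChartAt 𝓘(ℝ, E) x).symm) z = 0 := by
      have h1 := mvfderiv_comp (I := 𝓘(ℝ, E)) z (hf ((extChartAt 𝓘(ℝ, E) x).symm z)) hs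
      rw [h0, ContinuousLinearMap.zero_comp] at h1
      unfold mvfderiv at h1
      rw [mfderiv_eq_fderiv] at h1
      exact h1
    rw [← this]
    exact (mdifferentiableAt_iff_differentiableAt.1 hc).hasFDerivAt
  filter_upwards [(continuousAt_extChartAt (I := 𝓘(ℝ, E)) x).preimage_mem_nhds
    (Metric.ball_mem_nhds _ hr), extChartAt_source_mem_nhds (I := 𝓘(ℝ, E)) x] with y hy hys
  have := (convex_ball (extChartAt 𝓘(ℝ, E) x x) r).is_const_of_fderivWithin_eq_zero
    (f := f ∘ (extChartAt 𝓘(ℝ, E) x).symm) (𝕜 := ℝ)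
    (fun z hz => (hd z hz).differentiableAt.differentiableWithinAt)
    (fun z hz => by
      rw [fderivWithin_of_isOpen Metric.isOpen_ball hz, (hd z hz).fderiv])
    hy (Metric.mem_ball_self hr)
  simpa only [Function.comp_apply, (extChartAt 𝓘(ℝ, E) x).left_inv hys,
    (extChartAt 𝓘(ℝ, E) x).left_inv (mem_extChartAt_source x)] using this

end Calculus
end SU3

namespace SU3

/-! ### Linear algebra of a complex volume form on a Hermitian vector space -/

section LinearAlgebra

open Module

variable {V : Type*} [NormedAddCommGroup V] [InnerProductSpace ℝ V] [FiniteDimensional ℝ V]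

/-- `J` is an orthogonal complex structure on `V`. -/
structure IsOrthComplex (J : V →L[ℝ] V) : Prop where
  sq : ∀ u, J (J u) = -u
  orth : ∀ u v, inner ℝ (J u) (J v) = inner ℝ u v

/-- `e` is a unitary frame for `J`. -/
def IsUnitaryFrame (J : V →L[ℝ] V) (e : Fin 3 → V) : Prop :=
  (∀ i j, inner ℝ (e i) (e j) = if i = j then (1 : ℝ) else 0) ∧
    ∀ i j, inner ℝ (e i) (J (e j)) = (0 : ℝ)

theorem exists_unit_orthogonal (s : Finset V) (hs : s.card < finrank ℝ V) :
    ∃ v : V, inner ℝ v v = (1 : ℝ) ∧ ∀ w ∈ s, inner ℝ v w = (0 : ℝ) := by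
  have h1 : Submodule.span ℝ (s : Set V) ≠ ⊤ := by
    intro h
    have : finrank ℝ (Submodule.span ℝ (s : Set V)) ≤ s.card :=
      finrank_span_finset_le_card (R := ℝ) s
    rw [h, finrank_top] at this
    omega
  have h2 : (Submodule.span ℝ (s : Set V))ᗮ ≠ ⊥ := fun h =>
    h1 ((Submodule.orthogonal_eq_bot_iff).1 h)
  obtain ⟨v, hv, hv0⟩ := Submodule.exists_mem_ne_zero_of_ne_bot h2
  refine ⟨(‖v‖⁻¹) • v, ?_, fun w hw => ?_⟩
  · rw [real_inner_self_eq_norm_sq, norm_smul, norm_inv, norm_norm,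
      inv_mul_cancel₀ (norm_ne_zero_iff.2 hv0), one_pow]
  · rw [real_inner_smul_left, (Submodule.mem_orthogonal' _ _).1 hv w (Submodule.subset_span hw),
      mul_zero]

namespace IsOrthComplex

variable {J : V →L[ℝ] V} (hJ : IsOrthComplex J)
include hJ

theorem inner_left (u v : V) : inner ℝ (J u) v = -inner ℝ u (J v) := by
  rw [← hJ.orth u (J v), hJ.sq, inner_neg_right, neg_neg]

theorem inner_self (u : V) : inner ℝ u (J u) = (0 : ℝ) := by
  have := hJ.inner_left u u
  rw [real_inner_comm] at this
  linarith

/-- A unit vector is the first vector of a unitary frame. -/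
theorem exists_unitaryFrame (h6 : finrank ℝ V = 6) {u : V} (hu : inner ℝ u u = (1 : ℝ)) :
    ∃ e : Fin 3 → V, IsUnitaryFrame J e ∧ e 0 = u := by
  classical
  -- Complex Gram–Schmidt: being orthogonal to both `u` and `J u` is Hermitian orthogonality to `u`.
  -- At most 2, then 4, real conditions are imposed in dimension 6.
  obtain ⟨v, hv, hvu⟩ := exists_unit_orthogonal ({u, J u} : Finset V)
    (lt_of_le_of_lt Finset.card_le_two (by omega))
  obtain ⟨w, hw, hwu⟩ := exists_unit_orthogonal ({u, J u, v, J v} : Finset V)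
    (lt_of_le_of_lt Finset.card_le_four (by omega))
  have h1 := hvu u (by simp)
  have h2 := hvu (J u) (by simp)
  have h3 := hwu u (by simp)
  have h4 := hwu (J u) (by simp)
  have h5 := hwu v (by simp)
  have h6 := hwu (J v) (by simp)
  have swap : ∀ {a b : V}, inner ℝ a (J b) = (0 : ℝ) → inner ℝ b (J a) = (0 : ℝ) := by
    intro a b h
    rw [real_inner_comm, hJ.inner_left, h, neg_zero]
  refine ⟨![u, v, w], ⟨fun i j => ?_, fun i j => ?_⟩, rfl⟩
  · fin_cases i <;> fin_cases j <;>
      simp [-inner_self_eq_norm_sq_to_K, hu, hv, hw, h1, h3, h5, real_inner_comm u v ▸ h1, real_inner_comm u w ▸ h3,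
        real_inner_comm v w ▸ h5]
  · fin_cases i <;> fin_cases j <;>
      simp [hJ.inner_self, h2, h4, h6, swap h2, swap h4, swap h6]

end IsOrthComplex

namespace IsUnitaryFrame

variable {J : V →L[ℝ] V} {e : Fin 3 → V}

theorem inner_J_J (he : IsUnitaryFrame J e) (hJ : IsOrthComplex J) (i j : Fin 3) :
    inner ℝ (J (e i)) (J (e j)) = if i = j then (1 : ℝ) else 0 := by
  rw [hJ.orth, he.1]

theorem inner_J_left (he : IsUnitaryFrame J e) (i j : Fin 3) :
    inner ℝ (J (e i)) (e j) = (0 : ℝ) := by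
  rw [real_inner_comm, he.2]

theorem expand (he : IsUnitaryFrame J e) (hJ : IsOrthComplex J) (h6 : finrank ℝ V = 6) (X : V) :
    X = ∑ k, (inner ℝ (e k) X • e k + inner ℝ (J (e k)) X • J (e k)) := by
  have hon : Orthonormal ℝ (Sum.elim e fun k => J (e k)) := by
    rw [orthonormal_iff_ite]
    rintro (i | i) (j | j)
    · simp [he.1]
    · simp [he.2]
    · simp [he.inner_J_left]
    · simp [he.inner_J_J hJ]
  have hsp : ⊤ ≤ Submodule.span ℝ (Set.range (Sum.elim e fun k => J (e k))) := by
    rw [hon.linearIndependent.span_eq_top_of_card_eq_finrank' (by simp [h6])]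
  have h := (OrthonormalBasis.mk hon hsp).sum_repr' X
  simp only [OrthonormalBasis.coe_mk, Fintype.sum_sum_type, Sum.elim_inl, Sum.elim_inr] at h
  rw [Finset.sum_add_distrib]
  exact h.symm

/-- The complex coordinates with respect to a unitary frame. -/
noncomputable def coord (J : V →L[ℝ] V) (e : Fin 3 → V) (k : Fin 3) (X : V) : ℂ :=
  (inner ℝ (e k) X : ℝ) + Complex.I * (inner ℝ (J (e k)) X : ℝ)

/-- The Hermitian product `⟨X,Y⟩ + i⟨X,JY⟩`. -/
noncomputable def herm (J : V →L[ℝ] V) (X Y : V) : ℂ :=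
  (inner ℝ X Y : ℝ) + Complex.I * (inner ℝ X (J Y) : ℝ)

theorem inner_eq (he : IsUnitaryFrame J e) (hJ : IsOrthComplex J) (h6 : finrank ℝ V = 6)
    (X Y : V) : inner ℝ X Y =
      ∑ k, (inner ℝ (e k) X * inner ℝ (e k) Y + inner ℝ (J (e k)) X * inner ℝ (J (e k)) Y) := by
  conv_lhs => rw [he.expand hJ h6 X]
  simp only [sum_inner, inner_add_left, real_inner_smul_left]

/-- Parseval for the Hermitian product, which is complex linear in its first argument and conjugate
linear in its second. -/
theorem herm_eq (he : IsUnitaryFrame J e) (hJ : IsOrthComplex J) (h6 : finrank ℝ V = 6)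
    (X Y : V) : herm J X Y = ∑ k, coord J e k X * (starRingEnd ℂ) (coord J e k Y) := by
  have h1 : ∀ k, inner ℝ (e k) (J Y) = -inner ℝ (J (e k)) Y := fun k => by
    rw [hJ.inner_left, neg_neg]
  rw [herm, he.inner_eq hJ h6, he.inner_eq hJ h6 X (J Y)]
  simp only [hJ.orth, h1, coord]
  apply Complex.ext
  · simp
  · simp

theorem linear_eq_sum (he : IsUnitaryFrame J e) (hJ : IsOrthComplex J) (h6 : finrank ℝ V = 6)
    (L : V →ₗ[ℝ] ℂ) (hL : ∀ v, L (J v) = Complex.I * L v) (X : V) :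
    L X = ∑ k, coord J e k X * L (e k) := by
  conv_lhs => rw [he.expand hJ h6 X]
  simp only [map_sum, map_add, map_smul, hL, coord, Complex.real_smul]
  refine Finset.sum_congr rfl fun k _ => ?_
  ring

end IsUnitaryFrame

/-- `Ψ` is a complex volume form of unit length. -/
structure IsComplexVolume (J : V →L[ℝ] V) (Ψ : V [⋀^Fin 3]→L[ℝ] ℂ) : Prop where
  complex : ∀ (v : Fin 3 → V) (i : Fin 3),
    Ψ (Function.update v i (J (v i))) = Complex.I * Ψ v
  unit : ∀ e : Fin 3 → V, IsUnitaryFrame J e → ‖Ψ e‖ = 1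

section Alternating

variable (Ψ : V [⋀^Fin 3]→L[ℝ] ℂ) (a b c d : V)

omit [FiniteDimensional ℝ V]

theorem update_vec3_zero {α : Type*} (a b c d : α) : Function.update ![a, b, c] 0 d = ![d, b, c] := by
  ext i; fin_cases i <;> rfl

theorem update_vec3_one {α : Type*} (a b c d : α) : Function.update ![a, b, c] 1 d = ![a, d, c] := by
  ext i; fin_cases i <;> rfl

theorem update_vec3_two {α : Type*} (a b c d : α) : Function.update ![a, b, c] 2 d = ![a, b, d] := by
  ext i; fin_cases i <;> rfl

theorem alt_swap01 : Ψ ![b, a, c] = -Ψ ![a, b, c] := by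
  refine Eq.trans ?_ (Ψ.map_swap ![a, b, c] (i := 0) (j := 1) (by decide))
  exact congrArg Ψ (by ext i; fin_cases i <;> rfl)

theorem alt_swap12 : Ψ ![a, c, b] = -Ψ ![a, b, c] := by
  refine Eq.trans ?_ (Ψ.map_swap ![a, b, c] (i := 1) (j := 2) (by decide))
  exact congrArg Ψ (by ext i; fin_cases i <;> rfl)

theorem alt_cycle : Ψ ![b, c, a] = Ψ ![a, b, c] := by
  rw [alt_swap12, alt_swap01, neg_neg]

theorem alt_self01 : Ψ ![a, a, c] = 0 :=
  Ψ.map_eq_zero_of_eq ![a, a, c] (i := 0) (j := 1) rfl (by decide)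

theorem alt_self12 : Ψ ![a, c, c] = 0 :=
  Ψ.map_eq_zero_of_eq ![a, c, c] (i := 1) (j := 2) rfl (by decide)

theorem alt_self02 : Ψ ![c, a, c] = 0 :=
  Ψ.map_eq_zero_of_eq ![c, a, c] (i := 0) (j := 2) rfl (by decide)

/-- `Ψ(·,b,c)` as a linear map. -/
noncomputable def altLeft (Ψ : V [⋀^Fin 3]→L[ℝ] ℂ) (b c : V) : V →ₗ[ℝ] ℂ where
  toFun a := Ψ ![a, b, c]
  map_add' x y := by
    have := Ψ.map_update_add ![0, b, c] 0 x y
    rwa [update_vec3_zero, update_vec3_zero, update_vec3_zero] at this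
  map_smul' r x := by
    have := Ψ.map_update_smul ![0, b, c] 0 r x
    rwa [update_vec3_zero, update_vec3_zero] at this

@[simp] theorem altLeft_apply : altLeft Ψ b c a = Ψ ![a, b, c] := rfl

end Alternating

namespace IsComplexVolume

variable {J : V →L[ℝ] V} {Ψ : V [⋀^Fin 3]→L[ℝ] ℂ} (hΨ : IsComplexVolume J Ψ)
include hΨ

theorem J_left (a b c : V) : Ψ ![J a, b, c] = Complex.I * Ψ ![a, b, c] := by
  rw [← hΨ.complex ![a, b, c] 0, update_vec3_zero]; rfl

theorem J_mid (a b c : V) : Ψ ![a, J b, c] = Complex.I * Ψ ![a, b, c] := by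
  rw [← hΨ.complex ![a, b, c] 1, update_vec3_one]; rfl

theorem expand_left {e : Fin 3 → V} (he : IsUnitaryFrame J e) (hJ : IsOrthComplex J)
    (h6 : finrank ℝ V = 6) (X b c : V) :
    Ψ ![X, b, c] = ∑ k, IsUnitaryFrame.coord J e k X * Ψ ![e k, b, c] :=
  he.linear_eq_sum hJ h6 (altLeft Ψ b c) (fun v => hΨ.J_left v b c) X

/-- `Ψ = Ψ(e₀,e₁,e₂) dz₀ ∧ dz₁ ∧ dz₂`. -/
theorem eq_det {e : Fin 3 → V} (he : IsUnitaryFrame J e) (hJ : IsOrthComplex J)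
    (h6 : finrank ℝ V = 6) (X Y Z : V) :
    let z := IsUnitaryFrame.coord J e
    Ψ ![X, Y, Z] = Ψ e * (z 0 X * (z 1 Y * z 2 Z - z 2 Y * z 1 Z)
      - z 1 X * (z 0 Y * z 2 Z - z 2 Y * z 0 Z) + z 2 X * (z 0 Y * z 1 Z - z 1 Y * z 0 Z)) := by
  intro z
  have hP : Ψ e = Ψ ![e 0, e 1, e 2] := by
    congr 1
    ext i; fin_cases i <;> rfl
  have h0 : ∀ b c, Ψ ![X, b, c] = ∑ k, z k X * Ψ ![e k, b, c] := hΨ.expand_left he hJ h6 X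
  have h1 : ∀ a c, Ψ ![a, Y, c] = ∑ k, z k Y * Ψ ![a, e k, c] := fun a c => by
    simp only [alt_swap01 Ψ _ a, hΨ.expand_left he hJ h6 Y, mul_neg, Finset.sum_neg_distrib]
    rfl
  have h2 : ∀ a b, Ψ ![a, b, Z] = ∑ k, z k Z * Ψ ![a, b, e k] := fun a b => by
    simp only [alt_cycle Ψ _ a b, hΨ.expand_left he hJ h6 Z]
    rfl
  rw [hP, h0]
  simp only [h1, h2, Fin.sum_univ_three, alt_self01, alt_self12, alt_self02]
  have p1 := alt_swap01 Ψ (e 0) (e 1) (e 2)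
  have p2 := alt_swap12 Ψ (e 0) (e 1) (e 2)
  have p3 := alt_cycle Ψ (e 0) (e 1) (e 2)
  have p4 := alt_cycle Ψ (e 2) (e 0) (e 1)
  have p5 := alt_swap01 Ψ (e 1) (e 2) (e 0)
  rw [p3] at p5
  rw [p1, p2, p3, ← p4, p5]
  ring

/-- The contraction of `Ψ` with itself: if `T` represents `Re (conj W Ψ(u, ·, Y))`, then
`Ψ(T, A, B)` is a product of Hermitian products. -/
theorem apply_representer (hJ : IsOrthComplex J) (h6 : finrank ℝ V = 6) {a b : ℝ} {u Y T : V}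
    (hT : ∀ Z, inner ℝ Z T = a * (Ψ ![u, Z, Y]).re + b * (Ψ ![u, Z, Y]).im) (A B : V) :
    let h := IsUnitaryFrame.herm J
    Ψ ![T, A, B] = -(a + b * Complex.I) * (h A u * h B Y - h B u * h A Y) := by
  intro h
  obtain ⟨v, hv, -⟩ := exists_unit_orthogonal (V := V) ∅ (by simp [h6])
  obtain ⟨e, he, -⟩ := hJ.exists_unitaryFrame h6 hv
  have hP : Ψ e * (starRingEnd ℂ) (Ψ e) = 1 := by
    rw [Complex.mul_conj, Complex.normSq_eq_norm_sq, hΨ.unit e he]; simp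
  -- Moving `J` through the middle slot of Ψ turns the pairing with `J (e k)` into multiplication by
  -- i, so the two real pairings combine into one complex conjugate.
  have hz : ∀ k, IsUnitaryFrame.coord J e k T =
      (a + b * Complex.I) * (starRingEnd ℂ) (Ψ ![u, e k, Y]) := by
    intro k
    rw [IsUnitaryFrame.coord, hT, hT, hΨ.J_mid]
    apply Complex.ext <;> simp
  have hd := hΨ.eq_det he hJ h6
  have hc : ∀ i j, IsUnitaryFrame.coord J e i (e j) = if i = j then 1 else 0 := by
    intro i j
    rw [IsUnitaryFrame.coord, he.1, he.inner_J_left]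
    split_ifs <;> simp
  simp only [h, he.herm_eq hJ h6]
  rw [hΨ.expand_left he hJ h6]
  simp only [hz, hd, hc, Fin.sum_univ_three, map_add, map_mul, map_sub]
  simp only [Fin.isValue, reduceIte, Fin.reduceEq, map_one, map_zero]
  generalize (a : ℂ) + b * Complex.I = W
  set z := IsUnitaryFrame.coord J e
  let s (X Y : V) : ℂ := z 0 X * (starRingEnd ℂ) (z 0 Y) + z 1 X * (starRingEnd ℂ) (z 1 Y) +
    z 2 X * (starRingEnd ℂ) (z 2 Y)
  -- What remains is Lagrange's identity for cross products in ℂ³; the phase of `Ψ e` cancels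
  -- because `|Ψ e|² = 1`.
  linear_combination (-W * (s A u * s B Y - s B u * s A Y)) * hP

/-- The value on four vectors of `β ∧ Ψ`. -/
noncomputable def wedgeΨ (Ψ : V [⋀^Fin 3]→L[ℝ] ℂ) (β : V →ₗ[ℝ] ℂ) (v₀ v₁ v₂ v₃ : V) : ℂ :=
  β v₀ * Ψ ![v₁, v₂, v₃] - β v₁ * Ψ ![v₀, v₂, v₃] + β v₂ * Ψ ![v₀, v₁, v₃]
    - β v₃ * Ψ ![v₀, v₁, v₂]

/-- If `Re (β ∧ Ψ) = 0`, then `β` is of type `(1,0)`. -/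
theorem map_J_of_re_wedge_eq_zero (hJ : IsOrthComplex J) (h6 : finrank ℝ V = 6) {β : V →ₗ[ℝ] ℂ}
    (hβ : ∀ v₀ v₁ v₂ v₃, (wedgeΨ Ψ β v₀ v₁ v₂ v₃).re = 0) (u : V) :
    β (J u) = Complex.I * β u := by
  rcases eq_or_ne u 0 with rfl | hu
  · simp
  obtain ⟨e, he, heu⟩ := hJ.exists_unitaryFrame h6 (u := (‖u‖⁻¹) • u) (by
    rw [real_inner_self_eq_norm_sq, norm_smul, norm_inv, norm_norm,
      inv_mul_cancel₀ (norm_ne_zero_iff.2 hu), one_pow])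
  have hP : Ψ ![e 0, e 1, e 2] ≠ 0 := by
    have h1 : ![e 0, e 1, e 2] = e := by ext i; fin_cases i <;> rfl
    have := hΨ.unit e he
    rw [h1]
    intro h0
    simp [h0] at this
  -- With `J (e 0)` and `e 0` both present, the terms in which Ψ contains both of them vanish, and
  -- the other two differ by the factor i. This isolates the (0,1)-part of β on `e 0`.
  have key : ∀ v, wedgeΨ Ψ β (J (e 0)) (e 0) v (e 2) =
      (β (J (e 0)) - Complex.I * β (e 0)) * Ψ ![e 0, v, e 2] := by
    intro v
    simp only [wedgeΨ, hΨ.J_left, alt_self01]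
    ring
  have h1 := hβ (J (e 0)) (e 0) (e 1) (e 2)
  have h2 := hβ (J (e 0)) (e 0) (J (e 1)) (e 2)
  rw [key] at h1 h2
  rw [hΨ.J_mid] at h2
  -- Replacing `e 1` by `J (e 1)` multiplies the product by i, so the hypothesis on real parts
  -- controls the imaginary part as well.
  have h3 : (β (J (e 0)) - Complex.I * β (e 0)) * Ψ ![e 0, e 1, e 2] = 0 := by
    apply Complex.ext
    · exact h1
    · rw [mul_left_comm, Complex.I_mul_re] at h2
      simpa only [neg_eq_zero, Complex.zero_im] using h2
  have h4 := (mul_eq_zero.1 h3).resolve_right hP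
  have h5 : u = ‖u‖ • e 0 := by
    rw [heu, smul_smul, mul_inv_cancel₀ (norm_ne_zero_iff.2 hu), one_smul]
  rw [h5]
  simp only [map_smul, Complex.real_smul]
  linear_combination (‖u‖ : ℂ) * h4

/-- This is a form of type (4,0) in complex dimension three. In coordinates it is a 4×4 determinant
one of whose rows is a combination of the other three. -/
theorem wedge_eq_zero (hJ : IsOrthComplex J) (h6 : finrank ℝ V = 6) {β : V →ₗ[ℝ] ℂ}
    (hβ : ∀ u, β (J u) = Complex.I * β u) (v₀ v₁ v₂ v₃ : V) : wedgeΨ Ψ β v₀ v₁ v₂ v₃ = 0 := by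
  obtain ⟨v, hv, -⟩ := exists_unit_orthogonal (V := V) ∅ (by simp [h6])
  obtain ⟨e, he, -⟩ := hJ.exists_unitaryFrame h6 hv
  simp only [wedgeΨ, hΨ.eq_det he hJ h6]
  rw [he.linear_eq_sum hJ h6 β hβ v₀, he.linear_eq_sum hJ h6 β hβ v₁,
    he.linear_eq_sum hJ h6 β hβ v₂, he.linear_eq_sum hJ h6 β hβ v₃]
  simp only [Fin.sum_univ_three]
  ring

end IsComplexVolume
end LinearAlgebra
end SU3

namespace SU3
open VectorField Filter Topology

/-! ### Rules for directional derivatives of real functions -/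

section DirectionalDerivative

variable {E : Type*} [NormedAddCommGroup E] [NormedSpace ℝ E] [FiniteDimensional ℝ E]
  {M : Type*} [TopologicalSpace M] [ChartedSpace E M] [IsManifold 𝓘(ℝ, E) ∞ M]

/-- `f` is differentiable at `x` with derivative `c` in the direction `u`. -/
def HasDirDeriv (f : M → ℝ) (x : M) (u : TangentSpace 𝓘(ℝ, E) x) (c : ℝ) : Prop :=
  MDifferentiableAt 𝓘(ℝ, E) 𝓘(ℝ, ℝ) f x ∧ mvfderiv 𝓘(ℝ, E) f x u = c

namespace HasDirDeriv

variable {f g : M → ℝ} {x : M} {u : TangentSpace 𝓘(ℝ, E) x} {c d : ℝ}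

theorem _root_.MDifferentiableAt.hasDirDeriv (hf : MDifferentiableAt 𝓘(ℝ, E) 𝓘(ℝ, ℝ) f x)
    (u : TangentSpace 𝓘(ℝ, E) x) : HasDirDeriv f x u (mvfderiv 𝓘(ℝ, E) f x u) := ⟨hf, rfl⟩

theorem add (hf : HasDirDeriv f x u c) (hg : HasDirDeriv g x u d) :
    HasDirDeriv (fun y => f y + g y) x u (c + d) :=
  ⟨hf.1.add hg.1, by rw [← hf.2, ← hg.2]; exact DFunLike.congr_fun (mvfderiv_add hf.1 hg.1) u⟩

theorem sub (hf : HasDirDeriv f x u c) (hg : HasDirDeriv g x u d) :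
    HasDirDeriv (fun y => f y - g y) x u (c - d) :=
  ⟨hf.1.sub hg.1, by rw [← hf.2, ← hg.2]; exact DFunLike.congr_fun (mvfderiv_sub hf.1 hg.1) u⟩

theorem mul (hf : HasDirDeriv f x u c) (hg : HasDirDeriv g x u d) :
    HasDirDeriv (fun y => f y * g y) x u (f x * d + g x * c) :=
  ⟨hf.1.mul hg.1, by rw [← hf.2, ← hg.2]; exact DFunLike.congr_fun (mvfderiv_mul hf.1 hg.1) u⟩

theorem const_mul (r : ℝ) (hf : HasDirDeriv f x u c) :
    HasDirDeriv (fun y => r * f y) x u (r * c) := by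
  have h := (mdifferentiableAt_const (c := r) (I := 𝓘(ℝ, E)) (I' := 𝓘(ℝ, ℝ)) (x := x)).hasDirDeriv u
  have := h.mul hf
  rwa [mvfderiv_const, _root_.zero_apply, mul_zero, add_zero] at this

theorem congr (hf : HasDirDeriv f x u c) (h : g =ᶠ[𝓝 x] f) : HasDirDeriv g x u c := by
  refine ⟨hf.1.congr_of_eventuallyEq h, ?_⟩
  rw [← hf.2]
  unfold mvfderiv
  rw [h.mfderiv_eq]
  exact congrArg _ rfl

theorem unique (hf : HasDirDeriv f x u c) (hg : HasDirDeriv f x u d) : c = d :=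
  hf.2.symm.trans hg.2

end HasDirDeriv
end DirectionalDerivative

/-! ### The structure on a single tangent space -/

section Geometry

open Module
namespace SpecialAlmostHermitian

variable {E : Type*} [NormedAddCommGroup E] [NormedSpace ℝ E] [FiniteDimensional ℝ E]
  {M : Type*} [TopologicalSpace M] [ChartedSpace E M] [IsManifold 𝓘(ℝ, E) ∞ M]
  [RiemannianBundle (fun x : M => TangentSpace 𝓘(ℝ, E) x)]
  [IsContMDiffRiemannianBundle 𝓘(ℝ, E) ∞ E (fun x : M => TangentSpace 𝓘(ℝ, E) x)]
  (S : SpecialAlmostHermitian E M)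

theorem isOrthComplex (x : M) : IsOrthComplex (S.J x) := ⟨S.J_sq x, S.J_orthogonal x⟩

theorem isComplexVolume (x : M) : IsComplexVolume (S.J x) (S.Ψ x) :=
  ⟨S.Ψ_complex x, fun e he => S.Ψ_unit x e he.1 he.2⟩

instance (x : M) : FiniteDimensional ℝ (TangentSpace 𝓘(ℝ, E) x) :=
  inferInstanceAs (FiniteDimensional ℝ E)

theorem finrank_tangentSpace (hE : finrank ℝ E = 6) (x : M) :
    finrank ℝ (TangentSpace 𝓘(ℝ, E) x) = 6 := hE

theorem exists_frame (hE : finrank ℝ E = 6) (x : M) : ∃ e : Fin 3 → TangentSpace 𝓘(ℝ, E) x,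
    IsUnitaryFrame (S.J x) e ∧ S.Ψ x ![e 0, e 1, e 2] ≠ 0 := by
  obtain ⟨v, hv, -⟩ := exists_unit_orthogonal (V := TangentSpace 𝓘(ℝ, E) x) ∅
    (by rw [finrank_tangentSpace hE]; simp)
  obtain ⟨e, he, -⟩ := (S.isOrthComplex x).exists_unitaryFrame (finrank_tangentSpace hE x) hv
  refine ⟨e, he, fun h0 => ?_⟩
  have h1 : ![e 0, e 1, e 2] = e := by ext i; fin_cases i <;> rfl
  have := (S.isComplexVolume x).unit e he
  rw [← h1, h0] at this
  simp at this

end SpecialAlmostHermitian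
end Geometry
end SU3

namespace SU3
open VectorField Filter Topology Module

/-! ### Pointwise algebra of the exterior derivative of Ψ -/

section FormalDifferential

open IsUnitaryFrame

variable {V : Type*} [NormedAddCommGroup V] [InnerProductSpace ℝ V] [FiniteDimensional ℝ V]

/-- The term `Ψ(ξ_u X, Y, Z)` for an almost Hermitian structure with `∇ω = Re (conj W Ψ)`. -/
noncomputable def torsionTerm (J : V →L[ℝ] V) (W : ℂ) (u X Y Z : V) : ℂ :=
  Complex.I / 2 * W * (herm J Y u * herm J Z X - herm J Z u * herm J Y X)

/-- The derivative of `Ψ(X,Y,Z)` in the direction `u`, if `nX`, `nY`, `nZ` are the covariant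
derivatives of the fields `X`, `Y`, `Z` and `t` is the value on `u` of the one-form `Iη`. -/
noncomputable def derivΨ (J : V →L[ℝ] V) (Ψ : V [⋀^Fin 3]→L[ℝ] ℂ) (W : ℂ) (t : ℝ)
    (u X Y Z nX nY nZ : V) : ℂ :=
  Ψ ![nX, Y, Z] + Ψ ![X, nY, Z] + Ψ ![X, Y, nZ] + 3 * Complex.I * t * Ψ ![X, Y, Z]
    + torsionTerm J W u X Y Z - torsionTerm J W u Y X Z + torsionTerm J W u Z X Y

/-- Vanishing torsion is encoded by using one vector `n` for each pair of indices; the terms in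
these vectors then cancel in pairs. Among the torsion terms everything containing an inner product
cancels by symmetry, and only products of values of ω survive. The final bracket is half of ω∧ω on
four vectors, so the coefficient 4 amounts to 2iW ω∧ω. -/
theorem alternate_derivΨ {J : V →L[ℝ] V} (hJ : IsOrthComplex J) (Ψ : V [⋀^Fin 3]→L[ℝ] ℂ) (W : ℂ)
    (t₀ t₁ t₂ t₃ : ℝ) (X₀ X₁ X₂ X₃ n₀₁ n₀₂ n₀₃ n₁₂ n₁₃ n₂₃ : V) :
    let om (X Y : V) : ℂ := (inner ℝ X (J Y) : ℝ)
    derivΨ J Ψ W t₀ X₀ X₁ X₂ X₃ n₀₁ n₀₂ n₀₃ - derivΨ J Ψ W t₁ X₁ X₀ X₂ X₃ n₀₁ n₁₂ n₁₃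
      + derivΨ J Ψ W t₂ X₂ X₀ X₁ X₃ n₀₂ n₁₂ n₂₃ - derivΨ J Ψ W t₃ X₃ X₀ X₁ X₂ n₀₃ n₁₃ n₂₃
    = 3 * Complex.I * (t₀ * Ψ ![X₁, X₂, X₃] - t₁ * Ψ ![X₀, X₂, X₃] + t₂ * Ψ ![X₀, X₁, X₃]
      - t₃ * Ψ ![X₀, X₁, X₂])
      + 4 * Complex.I * W * (om X₀ X₁ * om X₂ X₃ - om X₀ X₂ * om X₁ X₃ + om X₀ X₃ * om X₁ X₂) := by
  intro om
  have hw : ∀ X Y : V, (inner ℝ Y (J X) : ℝ) = -inner ℝ X (J Y) := fun X Y => by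
    rw [real_inner_comm, hJ.inner_left]
  simp only [derivΨ, torsionTerm, herm, om]
  rw [alt_swap01 Ψ n₀₂ X₁ X₃, alt_swap01 Ψ n₁₂ X₀ X₃, alt_cycle Ψ n₀₃ X₁ X₂,
    alt_cycle Ψ n₁₃ X₀ X₂, alt_cycle Ψ n₂₃ X₀ X₁, alt_swap01 Ψ n₁₃ X₀ X₂,
    real_inner_comm X₁ X₀, real_inner_comm X₂ X₀, real_inner_comm X₃ X₀, real_inner_comm X₂ X₁,
    real_inner_comm X₃ X₁, real_inner_comm X₃ X₂,
    hw X₀ X₁, hw X₀ X₂, hw X₀ X₃, hw X₁ X₂, hw X₁ X₃, hw X₂ X₃]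
  push_cast
  generalize (inner ℝ X₀ (J X₁) : ℝ) = w01, (inner ℝ X₀ (J X₂) : ℝ) = w02,
    (inner ℝ X₀ (J X₃) : ℝ) = w03, (inner ℝ X₁ (J X₂) : ℝ) = w12,
    (inner ℝ X₁ (J X₃) : ℝ) = w13, (inner ℝ X₂ (J X₃) : ℝ) = w23
  linear_combination (-4 * Complex.I * W *
    (w01 * w23 - w02 * w13 + w03 * w12 : ℂ)) * Complex.I_sq

end FormalDifferential

/-! ### Derivatives of ω and Ψ along vector fields -/

section Geometry

namespace SpecialAlmostHermitian
open IsUnitaryFrame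

variable {E : Type*} [NormedAddCommGroup E] [NormedSpace ℝ E] [FiniteDimensional ℝ E]
  {M : Type*} [TopologicalSpace M] [ChartedSpace E M] [IsManifold 𝓘(ℝ, E) ∞ M]
  [RiemannianBundle (fun x : M => TangentSpace 𝓘(ℝ, E) x)]
  [IsContMDiffRiemannianBundle 𝓘(ℝ, E) ∞ E (fun x : M => TangentSpace 𝓘(ℝ, E) x)]
  (S : SpecialAlmostHermitian E M)
  {cov : CovariantDerivative 𝓘(ℝ, E) E (fun x : M => TangentSpace 𝓘(ℝ, E) x)}

theorem vec3_apply {X Y Z : Π y : M, TangentSpace 𝓘(ℝ, E) y} (y : M) :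
    (fun i => (![X, Y, Z] : Fin 3 → Π y : M, TangentSpace 𝓘(ℝ, E) y) i y) = ![X y, Y y, Z y] := by
  ext i; fin_cases i <;> rfl

section Smooth

variable {x : M} {X Y Z : Π y : M, TangentSpace 𝓘(ℝ, E) y}
  (hX : SmoothFieldAt X x) (hY : SmoothFieldAt Y x) (hZ : SmoothFieldAt Z x)
include hX hY

theorem contMDiffAt_inner : ContMDiffAt 𝓘(ℝ, E) 𝓘(ℝ, ℝ) ∞
    (fun y => (inner ℝ (X y) (Y y) : ℝ)) x :=
  ContMDiffAt.inner_bundle (F := E) (E := fun x : M => TangentSpace 𝓘(ℝ, E) x) hX hY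

theorem contMDiffAt_omega : ContMDiffAt 𝓘(ℝ, E) 𝓘(ℝ, ℝ) ∞
    (fun y => (inner ℝ (X y) (S.J y (Y y)) : ℝ)) x :=
  contMDiffAt_inner hX (S.J_smooth x Y hY)

include hZ

theorem smooth_vec3 (i : Fin 3) :
    SmoothFieldAt ((![X, Y, Z] : Fin 3 → Π y : M, TangentSpace 𝓘(ℝ, E) y) i) x := by
  fin_cases i
  exacts [hX, hY, hZ]

theorem contMDiffAt_re : ContMDiffAt 𝓘(ℝ, E) 𝓘(ℝ, ℝ) ∞
    (fun y => (S.Ψ y ![X y, Y y, Z y]).re) x := by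
  have := S.Ψ_re_smooth x ![X, Y, Z] (smooth_vec3 hX hY hZ)
  simpa only [vec3_apply] using this

theorem contMDiffAt_im : ContMDiffAt 𝓘(ℝ, E) 𝓘(ℝ, ℝ) ∞
    (fun y => (S.Ψ y ![X y, Y y, Z y]).im) x := by
  have := S.Ψ_im_smooth x ![X, Y, Z] (smooth_vec3 hX hY hZ)
  simpa only [vec3_apply] using this

end Smooth

theorem mvfderiv_inner (hcov : IsLeviCivita cov) {x : M} {X Y : Π y : M, TangentSpace 𝓘(ℝ, E) y}
    (hX : DiffFieldAt X x) (hY : DiffFieldAt Y x) (u : TangentSpace 𝓘(ℝ, E) x) :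
    mvfderiv 𝓘(ℝ, E) (fun y => (inner ℝ (X y) (Y y) : ℝ)) x u =
      inner ℝ (cov X x u) (Y x) + inner ℝ (X x) (cov Y x u) := by
  have h := hcov.1 x ![X, Y] (by intro i; fin_cases i; exacts [hX, hY]) u
  simp only [covDeriv, Fin.sum_univ_two, Matrix.cons_val_zero, Matrix.cons_val_one,
    Function.update_self, ne_eq, one_ne_zero, zero_ne_one, not_false_eq_true,
    Function.update_of_ne, Fin.isValue] at h
  exact sub_eq_zero.1 h

theorem mvfderiv_omega {x : M} {a b : ℝ} (hω : S.NablaOmegaEqAt cov x a b)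
    {X Y : Π y : M, TangentSpace 𝓘(ℝ, E) y}
    (hX : DiffFieldAt X x) (hY : DiffFieldAt Y x) (u : TangentSpace 𝓘(ℝ, E) x) :
    mvfderiv 𝓘(ℝ, E) (fun y => (inner ℝ (X y) (S.J y (Y y)) : ℝ)) x u =
      a * (S.Ψ x ![u, X x, Y x]).re + b * (S.Ψ x ![u, X x, Y x]).im +
      (inner ℝ (cov X x u) (S.J x (Y x)) + inner ℝ (X x) (S.J x (cov Y x u))) := by
  have h := hω ![X, Y] (by intro i; fin_cases i; exacts [hX, hY]) u
  simp only [covDeriv, omega, psiPlus, psiMinus, Fin.sum_univ_two, Matrix.cons_val_zero,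
    Matrix.cons_val_one, Function.update_self, ne_eq, one_ne_zero, zero_ne_one,
    not_false_eq_true, Function.update_of_ne, Fin.isValue] at h
  exact sub_eq_iff_eq_add.1 h

/-- `⟨Z, (∇_u J) Y⟩ = (∇_u ω)(Z, Y)`. -/
theorem inner_nablaJ (hcov : IsLeviCivita cov) {x : M} {a b : ℝ}
    (hω : S.NablaOmegaEqAt cov x a b) {Y : Π y : M, TangentSpace 𝓘(ℝ, E) y}
    (hY : SmoothFieldAt Y x) (u Z : TangentSpace 𝓘(ℝ, E) x) :
    inner ℝ Z (cov (applyField S.J Y) x u - S.J x (cov Y x u)) =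
      a * (S.Ψ x ![u, Z, Y x]).re + b * (S.Ψ x ![u, Z, Y x]).im := by
  have hZ : SmoothFieldAt (chartField (E := E) x Z) x :=
    chartField_smooth (E := E) x Z (mem_extChartAt_source x)
  have h1 := mvfderiv_inner hcov hZ.diffFieldAt (S.J_smooth x Y hY).diffFieldAt u
  have h2 := S.mvfderiv_omega hω hZ.diffFieldAt hY.diffFieldAt u
  simp only [applyField] at h1
  rw [h1, chartField_self] at h2
  rw [inner_sub_right]
  linarith

/-- The vector (∇_u J)Y represents Re(W̄Ψ(u,·,Y)) by `inner_nablaJ`, so `apply_representer` applies.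
The factor -½J in ξ contributes -i/2. -/
theorem psi_xi (hE : finrank ℝ E = 6) (hcov : IsLeviCivita cov) {x : M} {a b : ℝ}
    (hω : S.NablaOmegaEqAt cov x a b) {Y : Π y : M, TangentSpace 𝓘(ℝ, E) y}
    (hY : SmoothFieldAt Y x) (u A B : TangentSpace 𝓘(ℝ, E) x) :
    S.Ψ x ![S.xi cov Y x u, A, B] =
      torsionTerm (S.J x) (a + b * Complex.I) u (Y x) A B := by
  have h := (S.isComplexVolume x).apply_representer (S.isOrthComplex x)
    (finrank_tangentSpace hE x) (S.inner_nablaJ hcov hω hY u) A B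
  simp only at h
  have h2 := map_neg (altLeft (S.Ψ x) A B)
  have h3 := map_smul (altLeft (S.Ψ x) A B)
  simp only [altLeft_apply] at h2 h3
  rw [xi, h2, h3, (S.isComplexVolume x).J_left, h, torsionTerm, Complex.real_smul]
  push_cast
  ring

/-- `Ψ` on a vector of the connection `∇ + η + ξ`. -/
theorem psi_connection (hE : finrank ℝ E = 6) (hcov : IsLeviCivita cov) {x : M} {a b : ℝ}
    (hω : S.NablaOmegaEqAt cov x a b) (η : Π x : M, TangentSpace 𝓘(ℝ, E) x →L[ℝ] ℝ)
    {Y : Π y : M, TangentSpace 𝓘(ℝ, E) y}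
    (hY : SmoothFieldAt Y x) (u A B : TangentSpace 𝓘(ℝ, E) x) :
    S.Ψ x ![S.connection cov η Y x u, A, B] = S.Ψ x ![cov Y x u, A, B] +
      Complex.I * S.I η x u * S.Ψ x ![Y x, A, B] +
      torsionTerm (S.J x) (a + b * Complex.I) u (Y x) A B := by
  have h2 := map_add (altLeft (S.Ψ x) A B)
  have h3 := map_smul (altLeft (S.Ψ x) A B)
  simp only [altLeft_apply] at h2 h3
  rw [connection, h2, h2, h3, S.psi_xi hE hcov hω hY, (S.isComplexVolume x).J_left,
    Complex.real_smul]
  ring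

/-- The endomorphism J of the η-term acts as i in each of the three slots, which is where 3i Iη in
`derivΨ` comes from. -/
theorem mvfderiv_psi_aux (hE : finrank ℝ E = 6) (hcov : IsLeviCivita cov) {x : M} {a b : ℝ}
    (hω : S.NablaOmegaEqAt cov x a b) (η : Π x : M, TangentSpace 𝓘(ℝ, E) x →L[ℝ] ℝ)
    {X Y Z : Π y : M, TangentSpace 𝓘(ℝ, E) y}
    (hX : SmoothFieldAt X x) (hY : SmoothFieldAt Y x) (hZ : SmoothFieldAt Z x)
    (u : TangentSpace 𝓘(ℝ, E) x) :
    S.Ψ x ![S.connection cov η X x u, Y x, Z x] + S.Ψ x ![X x, S.connection cov η Y x u, Z x]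
      + S.Ψ x ![X x, Y x, S.connection cov η Z x u] =
    derivΨ (S.J x) (S.Ψ x) (a + b * Complex.I) (S.I η x u) u (X x) (Y x) (Z x)
      (cov X x u) (cov Y x u) (cov Z x u) := by
  rw [derivΨ, alt_swap01 _ _ (X x), alt_cycle _ _ (X x) (Y x),
    S.psi_connection hE hcov hω η hX, S.psi_connection hE hcov hω η hY,
    S.psi_connection hE hcov hω η hZ, alt_swap01 _ (cov Y x u) (X x),
    alt_cycle _ (cov Z x u) (X x) (Y x), alt_swap01 _ (X x) (Y x),
    ← alt_cycle _ (Z x) (X x) (Y x)]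
  ring

/-- Ψ is parallel for ∇ + η + ξ, so the derivative of a component is the sum over the slots of Ψ
with that connection inserted. -/
theorem hasDirDeriv_psi (hE : finrank ℝ E = 6) (hcov : IsLeviCivita cov) {x : M} {a b : ℝ}
    (hω : S.NablaOmegaEqAt cov x a b) {η : Π x : M, TangentSpace 𝓘(ℝ, E) x →L[ℝ] ℝ}
    (hη : S.IsTorsionOneForm cov η)
    {X Y Z : Π y : M, TangentSpace 𝓘(ℝ, E) y}
    (hX : SmoothFieldAt X x) (hY : SmoothFieldAt Y x) (hZ : SmoothFieldAt Z x)
    (u : TangentSpace 𝓘(ℝ, E) x) :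
    HasDirDeriv (fun y => (S.Ψ y ![X y, Y y, Z y]).re) x u
      (derivΨ (S.J x) (S.Ψ x) (a + b * Complex.I) (S.I η x u) u (X x) (Y x) (Z x)
      (cov X x u) (cov Y x u) (cov Z x u)).re ∧
    HasDirDeriv (fun y => (S.Ψ y ![X y, Y y, Z y]).im) x u
      (derivΨ (S.J x) (S.Ψ x) (a + b * Complex.I) (S.I η x u) u (X x) (Y x) (Z x)
      (cov X x u) (cov Y x u) (cov Z x u)).im := by
  have hd : ∀ i, DiffFieldAt ((![X, Y, Z] : Fin 3 → Π y : M, TangentSpace 𝓘(ℝ, E) y) i) x :=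
    fun i => (smooth_vec3 hX hY hZ i).diffFieldAt
  have h1 := hη.1 x _ hd u
  have h2 := hη.2 x _ hd u
  simp only [covDeriv, psiPlus, psiMinus, vec3_apply, Fin.sum_univ_three, update_vec3_zero,
    update_vec3_one, update_vec3_two] at h1 h2
  rw [← S.mvfderiv_psi_aux hE hcov hω η hX hY hZ u]
  refine ⟨⟨(S.contMDiffAt_re hX hY hZ).mdifferentiableAt (by simp), ?_⟩,
    ⟨(S.contMDiffAt_im hX hY hZ).mdifferentiableAt (by simp), ?_⟩⟩
  · simpa using sub_eq_zero.1 h1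
  · simpa using sub_eq_zero.1 h2

theorem cov_comm (hcov : IsLeviCivita cov) {x : M} {X Y : Π y : M, TangentSpace 𝓘(ℝ, E) y}
    (hX : DiffFieldAt X x) (hY : DiffFieldAt Y x) (h : mlieBracket 𝓘(ℝ, E) X Y x = 0) :
    cov Y x (X x) = cov X x (Y x) := by
  have h1 := cov.torsion_apply hX hY
  rw [hcov.2, h, sub_zero] at h1
  exact (sub_eq_zero.1 h1.symm)

end SpecialAlmostHermitian
end Geometry
end SU3

namespace SU3
open VectorField Filter Topology Module

/-! ### The exterior derivative of ω and smoothness of the coefficients -/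

section Geometry

namespace SpecialAlmostHermitian
open IsUnitaryFrame

variable {E : Type*} [NormedAddCommGroup E] [NormedSpace ℝ E] [FiniteDimensional ℝ E]
  {M : Type*} [TopologicalSpace M] [ChartedSpace E M] [IsManifold 𝓘(ℝ, E) ∞ M]
  [RiemannianBundle (fun x : M => TangentSpace 𝓘(ℝ, E) x)]
  [IsContMDiffRiemannianBundle 𝓘(ℝ, E) ∞ E (fun x : M => TangentSpace 𝓘(ℝ, E) x)]
  (S : SpecialAlmostHermitian E M)
  {cov : CovariantDerivative 𝓘(ℝ, E) E (fun x : M => TangentSpace 𝓘(ℝ, E) x)}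

/-- Components of `ω` in the chart at `x₀`. -/
noncomputable def om (x₀ : M) (v w : E) (y : M) : ℝ :=
  inner ℝ (chartField x₀ v y) (S.J y (chartField x₀ w y))

/-- Components of `ψ₊` in the chart at `x₀`. -/
noncomputable def re3 (x₀ : M) (u v w : E) (y : M) : ℝ :=
  (S.Ψ y ![chartField x₀ u y, chartField x₀ v y, chartField x₀ w y]).re

/-- Components of `ψ₋` in the chart at `x₀`. -/
noncomputable def im3 (x₀ : M) (u v w : E) (y : M) : ℝ :=
  (S.Ψ y ![chartField x₀ u y, chartField x₀ v y, chartField x₀ w y]).im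

/-- The derivative of a function in a coordinate direction. -/
noncomputable def dirD (x₀ : M) (v : E) (f : M → ℝ) (y : M) : ℝ :=
  mvfderiv 𝓘(ℝ, E) f y (chartField x₀ v y)

section Chart

variable {x₀ y : M} (hy : y ∈ (extChartAt 𝓘(ℝ, E) x₀).source)
include hy

theorem contMDiffAt_om (v w : E) : ContMDiffAt 𝓘(ℝ, E) 𝓘(ℝ, ℝ) ∞ (S.om x₀ v w) y :=
  S.contMDiffAt_omega (chartField_smooth x₀ v hy) (chartField_smooth x₀ w hy)

theorem contMDiffAt_re3 (u v w : E) : ContMDiffAt 𝓘(ℝ, E) 𝓘(ℝ, ℝ) ∞ (S.re3 x₀ u v w) y :=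
  S.contMDiffAt_re (chartField_smooth x₀ u hy) (chartField_smooth x₀ v hy)
    (chartField_smooth x₀ w hy)

theorem contMDiffAt_im3 (u v w : E) : ContMDiffAt 𝓘(ℝ, E) 𝓘(ℝ, ℝ) ∞ (S.im3 x₀ u v w) y :=
  S.contMDiffAt_im (chartField_smooth x₀ u hy) (chartField_smooth x₀ v hy)
    (chartField_smooth x₀ w hy)

theorem contMDiffAt_dirD (v : E) {f : M → ℝ} (hf : ContMDiffAt 𝓘(ℝ, E) 𝓘(ℝ, ℝ) ∞ f y) :
    ContMDiffAt 𝓘(ℝ, E) 𝓘(ℝ, ℝ) ∞ (dirD x₀ v f) y :=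
  contMDiffAt_mvfderiv hf (chartField_smooth x₀ v hy)

theorem dirD_comm (v w : E) {f : M → ℝ} (hf : ContMDiffAt 𝓘(ℝ, E) 𝓘(ℝ, ℝ) ∞ f y) :
    dirD x₀ v (dirD x₀ w f) y = dirD x₀ w (dirD x₀ v f) y := by
  have h := mvfderiv_mvfderiv_sub hf (chartField_smooth x₀ v hy).diffFieldAt
    (chartField_smooth x₀ w hy).diffFieldAt
  rw [chartField_bracket x₀ v w hy, map_zero] at h
  exact sub_eq_zero.1 h

theorem cov_chartField_comm (hcov : IsLeviCivita cov) (v w : E) :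
    cov (chartField x₀ w) y (chartField x₀ v y) = cov (chartField x₀ v) y (chartField x₀ w y) :=
  cov_comm hcov (chartField_smooth x₀ v hy).diffFieldAt (chartField_smooth x₀ w hy).diffFieldAt
    (chartField_bracket x₀ v w hy)

/-- `dω = 3 (w₊ ψ₊ + w₋ ψ₋)`. -/
theorem d_omega (hcov : IsLeviCivita cov) {a b : ℝ} (hω : S.NablaOmegaEqAt cov y a b)
    (u v w : E) :
    dirD x₀ u (S.om x₀ v w) y - dirD x₀ v (S.om x₀ u w) y + dirD x₀ w (S.om x₀ u v) y =
      3 * (a * S.re3 x₀ u v w y + b * S.im3 x₀ u v w y) := by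
  have h1 := fun p q t => S.mvfderiv_omega hω (chartField_smooth x₀ p hy).diffFieldAt
    (chartField_smooth x₀ q hy).diffFieldAt (chartField x₀ t y)
  have hr : ∀ A B : TangentSpace 𝓘(ℝ, E) y, inner ℝ A (S.J y B) = -inner ℝ B (S.J y A) :=
    fun A B => by rw [real_inner_comm, (S.isOrthComplex y).inner_left]
  simp only [dirD]
  unfold om re3 im3
  -- The terms with covariant derivatives of the fields cancel by vanishing torsion. The three terms
  -- of ∇ω agree because Ψ is alternating, hence the factor 3.
  rw [h1 v w u, h1 u w v, h1 u v w, cov_chartField_comm hy hcov v u,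
    cov_chartField_comm hy hcov w u, cov_chartField_comm hy hcov w v,
    alt_swap01 _ (chartField x₀ u y) (chartField x₀ v y),
    ← alt_cycle _ (chartField x₀ w y) (chartField x₀ u y),
    hr (chartField x₀ v y)]
  simp only [Complex.neg_re, Complex.neg_im]
  ring

end Chart

/-- The coefficients of `∇ω` are smooth. -/
theorem contMDiffAt_coeff (hE : finrank ℝ E = 6) (hcov : IsLeviCivita cov) {wp wm : M → ℝ}
    (hω : ∀ x, S.NablaOmegaEqAt cov x (wp x) (wm x)) (x : M) :
    ContMDiffAt 𝓘(ℝ, E) 𝓘(ℝ, ℝ) ∞ wp x ∧ ContMDiffAt 𝓘(ℝ, E) 𝓘(ℝ, ℝ) ∞ wm x := by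
  obtain ⟨e, he, hP⟩ := S.exists_frame hE x
  have hx := mem_extChartAt_source (I := 𝓘(ℝ, E)) x
  obtain ⟨e₀, h₀⟩ : ∃ v : E, chartField x v x = e 0 := ⟨e 0, chartField_self x (e 0)⟩
  obtain ⟨e₁, h₁⟩ : ∃ v : E, chartField x v x = e 1 := ⟨e 1, chartField_self x (e 1)⟩
  obtain ⟨e₂, h₂⟩ : ∃ v : E, chartField x v x = e 2 := ⟨e 2, chartField_self x (e 2)⟩
  obtain ⟨j₀, hj⟩ : ∃ v : E, chartField x v x = S.J x (e 0) :=
    ⟨S.J x (e 0), chartField_self x (S.J x (e 0))⟩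
  let p₁ := S.re3 x e₀ e₁ e₂
  let q₁ := S.im3 x e₀ e₁ e₂
  let p₂ := S.re3 x j₀ e₁ e₂
  let q₂ := S.im3 x j₀ e₁ e₂
  -- Evaluating dω/3 with first argument extending `e 0`, then `J (e 0)`, gives a 2×2 linear system
  -- for `wp` and `wm` with smooth coefficients, solved by Cramer's rule.
  let A := fun t y => 1 / 3 * (dirD x t (S.om x e₁ e₂) y - dirD x e₁ (S.om x t e₂) y +
    dirD x e₂ (S.om x t e₁) y)
  have hp₁ : ContMDiffAt 𝓘(ℝ, E) 𝓘(ℝ, ℝ) ∞ p₁ x := S.contMDiffAt_re3 hx _ _ _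
  have hq₁ : ContMDiffAt 𝓘(ℝ, E) 𝓘(ℝ, ℝ) ∞ q₁ x := S.contMDiffAt_im3 hx _ _ _
  have hp₂ : ContMDiffAt 𝓘(ℝ, E) 𝓘(ℝ, ℝ) ∞ p₂ x := S.contMDiffAt_re3 hx _ _ _
  have hq₂ : ContMDiffAt 𝓘(ℝ, E) 𝓘(ℝ, ℝ) ∞ q₂ x := S.contMDiffAt_im3 hx _ _ _
  have hA : ∀ t, ContMDiffAt 𝓘(ℝ, E) 𝓘(ℝ, ℝ) ∞ (A t) x := fun t =>
    contMDiffAt_const.mul (((contMDiffAt_dirD hx _ (S.contMDiffAt_om hx _ _)).sub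
      (contMDiffAt_dirD hx _ (S.contMDiffAt_om hx _ _))).add
      (contMDiffAt_dirD hx _ (S.contMDiffAt_om hx _ _)))
  have hdet : ContMDiffAt 𝓘(ℝ, E) 𝓘(ℝ, ℝ) ∞ (fun y => p₁ y * q₂ y - q₁ y * p₂ y) x :=
    (hp₁.mul hq₂).sub (hq₁.mul hp₂)
  -- At `x` the determinant is |Ψ(e₀,e₁,e₂)|². The field of `j₀` is J applied to that of `e₀` only
  -- at `x` itself, so nearby one has to use continuity.
  have hdet0 : p₁ x * q₂ x - q₁ x * p₂ x ≠ 0 := by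
    simp only [p₁, p₂, q₁, q₂, re3, im3, h₀, h₁, h₂, hj, (S.isComplexVolume x).J_left]
    intro h0
    apply hP
    rw [← Complex.normSq_eq_zero, Complex.normSq_apply, ← h0]
    simp
  have hev : ∀ᶠ y in 𝓝 x, p₁ y * q₂ y - q₁ y * p₂ y ≠ 0 ∧
      A e₀ y = wp y * p₁ y + wm y * q₁ y ∧
      A j₀ y = wp y * p₂ y + wm y * q₂ y := by
    filter_upwards [hdet.continuousAt.eventually_ne hdet0,
      extChartAt_source_mem_nhds (I := 𝓘(ℝ, E)) x] with y h1 h2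
    refine ⟨h1, ?_, ?_⟩
    · simp only [A]
      rw [S.d_omega h2 hcov (hω y)]
      ring
    · simp only [A]
      rw [S.d_omega h2 hcov (hω y)]
      ring
  constructor
  · refine ((((hA e₀).mul hq₂).sub ((hA j₀).mul hq₁)).div₀ hdet
      hdet0).congr_of_eventuallyEq ?_
    filter_upwards [hev] with y hy
    obtain ⟨h1, h2, h3⟩ := hy
    simp only [Pi.div_apply, Pi.mul_apply]
    rw [eq_div_iff h1, h2, h3]
    ring
  · refine ((((hA j₀).mul hp₁).sub ((hA e₀).mul hp₂)).div₀ hdet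
      hdet0).congr_of_eventuallyEq ?_
    filter_upwards [hev] with y hy
    obtain ⟨h1, h2, h3⟩ := hy
    simp only [Pi.div_apply, Pi.mul_apply]
    rw [eq_div_iff h1, h2, h3]
    ring

end SpecialAlmostHermitian
end Geometry
end SU3

namespace SU3
open VectorField Filter Topology Module

/-! ### The exterior derivative of W̄Ψ -/

section Geometry

namespace SpecialAlmostHermitian
open IsUnitaryFrame

variable {E : Type*} [NormedAddCommGroup E] [NormedSpace ℝ E] [FiniteDimensional ℝ E]
  {M : Type*} [TopologicalSpace M] [ChartedSpace E M] [IsManifold 𝓘(ℝ, E) ∞ M]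
  [RiemannianBundle (fun x : M => TangentSpace 𝓘(ℝ, E) x)]
  [IsContMDiffRiemannianBundle 𝓘(ℝ, E) ∞ E (fun x : M => TangentSpace 𝓘(ℝ, E) x)]
  (S : SpecialAlmostHermitian E M)
  {cov : CovariantDerivative 𝓘(ℝ, E) E (fun x : M => TangentSpace 𝓘(ℝ, E) x)}
  (wp wm : M → ℝ) (η : Π x : M, TangentSpace 𝓘(ℝ, E) x →L[ℝ] ℝ)

/-- Components of `Re (conj W Ψ) = w₊ ψ₊ + w₋ ψ₋`. -/
noncomputable def reW (x₀ : M) (u v w : E) (y : M) : ℝ :=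
  wp y * S.re3 x₀ u v w y + wm y * S.im3 x₀ u v w y

/-- Components of `Im (conj W Ψ) = w₊ ψ₋ - w₋ ψ₊`. -/
noncomputable def imW (x₀ : M) (u v w : E) (y : M) : ℝ :=
  wp y * S.im3 x₀ u v w y - wm y * S.re3 x₀ u v w y

/-- The complex one-form `d (conj W) + 3 i conj W Iη`. -/
noncomputable def beta (y : M) : TangentSpace 𝓘(ℝ, E) y →ₗ[ℝ] ℂ where
  toFun t := mvfderiv 𝓘(ℝ, E) wp y t - Complex.I * mvfderiv 𝓘(ℝ, E) wm y t +
    3 * Complex.I * (wp y - Complex.I * wm y) * S.I η y t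
  map_add' s t := by
    simp only [map_add]
    push_cast
    ring
  map_smul' r t := by
    simp only [map_smul, smul_eq_mul, RingHom.id_apply, Complex.real_smul]
    push_cast
    ring

section

variable {S wp wm η} (hE : finrank ℝ E = 6) (hcov : IsLeviCivita cov)
  (hω : ∀ x, S.NablaOmegaEqAt cov x (wp x) (wm x)) {x₀ y : M}
include hE hcov hω

theorem contMDiffAt_imW (hy : y ∈ (extChartAt 𝓘(ℝ, E) x₀).source) (u v w : E) :
    ContMDiffAt 𝓘(ℝ, E) 𝓘(ℝ, ℝ) ∞ (S.imW wp wm x₀ u v w) y :=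
  ((S.contMDiffAt_coeff hE hcov hω y).1.mul (S.contMDiffAt_im3 hy u v w)).sub
    ((S.contMDiffAt_coeff hE hcov hω y).2.mul (S.contMDiffAt_re3 hy u v w))

theorem hasDirDeriv_reW_imW (hη : S.IsTorsionOneForm cov η)
    (hy : y ∈ (extChartAt 𝓘(ℝ, E) x₀).source) (u v w : E) (t : TangentSpace 𝓘(ℝ, E) y) :
    let d : ℂ := (mvfderiv 𝓘(ℝ, E) wp y t - Complex.I * mvfderiv 𝓘(ℝ, E) wm y t) *
        S.Ψ y ![chartField x₀ u y, chartField x₀ v y, chartField x₀ w y] +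
      (wp y - Complex.I * wm y) * derivΨ (S.J y) (S.Ψ y) (wp y + wm y * Complex.I) (S.I η y t) t
        (chartField x₀ u y) (chartField x₀ v y) (chartField x₀ w y)
        (cov (chartField x₀ u) y t) (cov (chartField x₀ v) y t) (cov (chartField x₀ w) y t)
    HasDirDeriv (S.reW wp wm x₀ u v w) y t d.re ∧ HasDirDeriv (S.imW wp wm x₀ u v w) y t d.im := by
  intro d
  have hp := ((S.contMDiffAt_coeff hE hcov hω y).1.mdifferentiableAt (by simp)).hasDirDeriv t
  have hm := ((S.contMDiffAt_coeff hE hcov hω y).2.mdifferentiableAt (by simp)).hasDirDeriv t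
  obtain ⟨h1, h2⟩ := S.hasDirDeriv_psi hE hcov (hω y) hη (chartField_smooth x₀ u hy)
    (chartField_smooth x₀ v hy) (chartField_smooth x₀ w hy) t
  constructor
  · have h := (hp.mul h1).add (hm.mul h2)
    refine ⟨h.1, h.2.trans ?_⟩
    simp only [d, Complex.add_re, Complex.mul_re, Complex.sub_re, Complex.sub_im, Complex.mul_im,
      Complex.I_re, Complex.I_im, Complex.ofReal_re, Complex.ofReal_im]
    ring
  · have h := (hp.mul h2).sub (hm.mul h1)
    refine ⟨h.1, h.2.trans ?_⟩
    simp only [d, Complex.add_im, Complex.mul_re, Complex.sub_re, Complex.sub_im, Complex.mul_im,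
      Complex.I_re, Complex.I_im, Complex.ofReal_re, Complex.ofReal_im]
    ring

/-- `d (conj W Ψ) = β ∧ Ψ + 2 i |W|² ω ∧ ω`. -/
theorem d_reW_imW (hη : S.IsTorsionOneForm cov η)
    (hy : y ∈ (extChartAt 𝓘(ℝ, E) x₀).source) (v₀ v₁ v₂ v₃ : E) :
    (dirD x₀ v₀ (S.reW wp wm x₀ v₁ v₂ v₃) y - dirD x₀ v₁ (S.reW wp wm x₀ v₀ v₂ v₃) y
      + dirD x₀ v₂ (S.reW wp wm x₀ v₀ v₁ v₃) y - dirD x₀ v₃ (S.reW wp wm x₀ v₀ v₁ v₂) y =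
      (IsComplexVolume.wedgeΨ (S.Ψ y) (S.beta wp wm η y) (chartField x₀ v₀ y) (chartField x₀ v₁ y)
        (chartField x₀ v₂ y) (chartField x₀ v₃ y)).re) ∧
    (dirD x₀ v₀ (S.imW wp wm x₀ v₁ v₂ v₃) y - dirD x₀ v₁ (S.imW wp wm x₀ v₀ v₂ v₃) y
      + dirD x₀ v₂ (S.imW wp wm x₀ v₀ v₁ v₃) y - dirD x₀ v₃ (S.imW wp wm x₀ v₀ v₁ v₂) y =
      (IsComplexVolume.wedgeΨ (S.Ψ y) (S.beta wp wm η y) (chartField x₀ v₀ y) (chartField x₀ v₁ y)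
        (chartField x₀ v₂ y) (chartField x₀ v₃ y)).im +
      4 * (wp y ^ 2 + wm y ^ 2) * (S.om x₀ v₀ v₁ y * S.om x₀ v₂ v₃ y
        - S.om x₀ v₀ v₂ y * S.om x₀ v₁ v₃ y + S.om x₀ v₀ v₃ y * S.om x₀ v₁ v₂ y)) := by
  have hd := fun u v w t => hasDirDeriv_reW_imW hE hcov hω hη hy u v w (chartField x₀ t y)
  have ha := alternate_derivΨ (S.isOrthComplex y) (S.Ψ y) (wp y + wm y * Complex.I)
    (S.I η y (chartField x₀ v₀ y)) (S.I η y (chartField x₀ v₁ y)) (S.I η y (chartField x₀ v₂ y))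
    (S.I η y (chartField x₀ v₃ y)) (chartField x₀ v₀ y) (chartField x₀ v₁ y) (chartField x₀ v₂ y)
    (chartField x₀ v₃ y) (cov (chartField x₀ v₁) y (chartField x₀ v₀ y))
    (cov (chartField x₀ v₂) y (chartField x₀ v₀ y)) (cov (chartField x₀ v₃) y (chartField x₀ v₀ y))
    (cov (chartField x₀ v₂) y (chartField x₀ v₁ y)) (cov (chartField x₀ v₃) y (chartField x₀ v₁ y))
    (cov (chartField x₀ v₃) y (chartField x₀ v₂ y))
  have hc := fun v w => cov_chartField_comm hy hcov v w
  have hD : ∀ u v w t, ((dirD x₀ t (S.reW wp wm x₀ u v w) y : ℝ) : ℂ) +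
      Complex.I * (dirD x₀ t (S.imW wp wm x₀ u v w) y : ℝ) =
      ((mvfderiv 𝓘(ℝ, E) wp y (chartField x₀ t y) : ℝ) -
          Complex.I * (mvfderiv 𝓘(ℝ, E) wm y (chartField x₀ t y) : ℝ)) *
          S.Ψ y ![chartField x₀ u y, chartField x₀ v y, chartField x₀ w y] +
        (wp y - Complex.I * wm y) * derivΨ (S.J y) (S.Ψ y) (wp y + wm y * Complex.I)
          (S.I η y (chartField x₀ t y)) (chartField x₀ t y)
          (chartField x₀ u y) (chartField x₀ v y) (chartField x₀ w y)
          (cov (chartField x₀ u) y (chartField x₀ t y)) (cov (chartField x₀ v) y (chartField x₀ t y))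
          (cov (chartField x₀ w) y (chartField x₀ t y)) := fun u v w t => by
    rw [dirD, dirD, (hd u v w t).1.2, (hd u v w t).2.2]
    exact (congrArg _ (mul_comm _ _)).trans (Complex.re_add_im _)
  have key : (((dirD x₀ v₀ (S.reW wp wm x₀ v₁ v₂ v₃) y - dirD x₀ v₁ (S.reW wp wm x₀ v₀ v₂ v₃) y
      + dirD x₀ v₂ (S.reW wp wm x₀ v₀ v₁ v₃) y - dirD x₀ v₃ (S.reW wp wm x₀ v₀ v₁ v₂) y : ℝ) : ℂ) +
      Complex.I * ((dirD x₀ v₀ (S.imW wp wm x₀ v₁ v₂ v₃) y - dirD x₀ v₁ (S.imW wp wm x₀ v₀ v₂ v₃) y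
      + dirD x₀ v₂ (S.imW wp wm x₀ v₀ v₁ v₃) y - dirD x₀ v₃ (S.imW wp wm x₀ v₀ v₁ v₂) y : ℝ) : ℂ)) =
      IsComplexVolume.wedgeΨ (S.Ψ y) (S.beta wp wm η y) (chartField x₀ v₀ y) (chartField x₀ v₁ y)
        (chartField x₀ v₂ y) (chartField x₀ v₃ y) +
      Complex.I * (4 * (wp y ^ 2 + wm y ^ 2) * (S.om x₀ v₀ v₁ y * S.om x₀ v₂ v₃ y
        - S.om x₀ v₀ v₂ y * S.om x₀ v₁ v₃ y + S.om x₀ v₀ v₃ y * S.om x₀ v₁ v₂ y) : ℝ) := by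
    have e0 := hD v₁ v₂ v₃ v₀
    have e1 := hD v₀ v₂ v₃ v₁
    have e2 := hD v₀ v₁ v₃ v₂
    have e3 := hD v₀ v₁ v₂ v₃
    -- These symmetries bring the covariant derivatives into the shared form that `alternate_derivΨ`
    -- expects.
    rw [hc v₁ v₀] at e1
    rw [hc v₂ v₀, hc v₂ v₁] at e2
    rw [hc v₃ v₀, hc v₃ v₁, hc v₃ v₂] at e3
    simp only at ha
    simp only [IsComplexVolume.wedgeΨ, beta, LinearMap.coe_mk, AddHom.coe_mk, om]
    push_cast
    -- The correction by `Complex.I_sq` turns W̄W into w₊² + w₋².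
    linear_combination e0 - e1 + e2 - e3 + (wp y - Complex.I * wm y : ℂ) * ha - 4 * Complex.I *
      wm y ^ 2 * ((inner ℝ (chartField x₀ v₀ y) (S.J y (chartField x₀ v₁ y)) : ℝ) *
        (inner ℝ (chartField x₀ v₂ y) (S.J y (chartField x₀ v₃ y)) : ℝ) -
        (inner ℝ (chartField x₀ v₀ y) (S.J y (chartField x₀ v₂ y)) : ℝ) *
        (inner ℝ (chartField x₀ v₁ y) (S.J y (chartField x₀ v₃ y)) : ℝ) +
        (inner ℝ (chartField x₀ v₀ y) (S.J y (chartField x₀ v₃ y)) : ℝ) *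
        (inner ℝ (chartField x₀ v₁ y) (S.J y (chartField x₀ v₂ y)) : ℝ) : ℂ) * Complex.I_sq
  have h1 := congrArg Complex.re key
  have h2 := congrArg Complex.im key
  simp only [Complex.add_re, Complex.add_im, Complex.mul_re, Complex.mul_im, Complex.I_re,
    Complex.I_im, Complex.ofReal_re, Complex.ofReal_im] at h1 h2
  exact ⟨by linarith, by linarith⟩

/-- `Re (conj W Ψ)` is closed. -/
theorem d_reW_eq_zero (hy : y ∈ (extChartAt 𝓘(ℝ, E) x₀).source) (v₀ v₁ v₂ v₃ : E) :
    dirD x₀ v₀ (S.reW wp wm x₀ v₁ v₂ v₃) y - dirD x₀ v₁ (S.reW wp wm x₀ v₀ v₂ v₃) y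
      + dirD x₀ v₂ (S.reW wp wm x₀ v₀ v₁ v₃) y - dirD x₀ v₃ (S.reW wp wm x₀ v₀ v₁ v₂) y = 0 := by
  -- By `d_omega` the form is dω/3 on the whole chart domain, so its derivatives may be taken and
  -- the claim becomes ddω = 0.
  have hd : ∀ t u v w : E, dirD x₀ t (S.reW wp wm x₀ u v w) y = 1 / 3 *
      (dirD x₀ t (dirD x₀ u (S.om x₀ v w)) y - dirD x₀ t (dirD x₀ v (S.om x₀ u w)) y +
        dirD x₀ t (dirD x₀ w (S.om x₀ u v)) y) := by
    intro t u v w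
    have hD : ∀ p q r, HasDirDeriv (dirD x₀ p (S.om x₀ q r)) y (chartField x₀ t y)
        (dirD x₀ t (dirD x₀ p (S.om x₀ q r)) y) := fun p q r =>
      ((contMDiffAt_dirD hy p (S.contMDiffAt_om hy q r)).mdifferentiableAt (by simp)).hasDirDeriv _
    refine ((((hD u v w).sub (hD v u w)).add (hD w u v)).const_mul (1 / 3) |>.congr ?_).2
    filter_upwards [(isOpen_extChartAt_source (I := 𝓘(ℝ, E)) x₀).mem_nhds hy] with z hz
    rw [S.d_omega hz hcov (hω z), reW]
    ring
  have hs := fun v w p q => dirD_comm hy v w (S.contMDiffAt_om hy p q)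
  rw [hd, hd, hd, hd, hs v₁ v₀, hs v₂ v₀, hs v₃ v₀, hs v₂ v₁, hs v₃ v₁, hs v₃ v₂]
  ring

/-- The term 2iα ω∧ω in d(W̄Ψ) is purely imaginary, so closedness of Re(W̄Ψ) says exactly Re(β∧Ψ) =
0. -/
theorem beta_J (hη : S.IsTorsionOneForm cov η) (u : TangentSpace 𝓘(ℝ, E) y) :
    S.beta wp wm η y (S.J y u) = Complex.I * S.beta wp wm η y u := by
  refine (S.isComplexVolume y).map_J_of_re_wedge_eq_zero (S.isOrthComplex y)
    (finrank_tangentSpace hE y) (fun u₀ u₁ u₂ u₃ => ?_) u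
  have hy := mem_extChartAt_source (I := 𝓘(ℝ, E)) y
  have hs : ∀ u : TangentSpace 𝓘(ℝ, E) y, ∃ v : E, chartField y v y = u :=
    fun u => ⟨u, chartField_self y u⟩
  obtain ⟨v₀, rfl⟩ := hs u₀
  obtain ⟨v₁, rfl⟩ := hs u₁
  obtain ⟨v₂, rfl⟩ := hs u₂
  obtain ⟨v₃, rfl⟩ := hs u₃
  rw [← (d_reW_imW hE hcov hω hη hy v₀ v₁ v₂ v₃).1]
  exact d_reW_eq_zero hE hcov hω hy v₀ v₁ v₂ v₃

/-- `d Im (conj W Ψ) = 2 |W|² ω ∧ ω`. -/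
theorem d_imW (hη : S.IsTorsionOneForm cov η)
    (hy : y ∈ (extChartAt 𝓘(ℝ, E) x₀).source) (v₀ v₁ v₂ v₃ : E) :
    dirD x₀ v₀ (S.imW wp wm x₀ v₁ v₂ v₃) y - dirD x₀ v₁ (S.imW wp wm x₀ v₀ v₂ v₃) y
      + dirD x₀ v₂ (S.imW wp wm x₀ v₀ v₁ v₃) y - dirD x₀ v₃ (S.imW wp wm x₀ v₀ v₁ v₂) y =
      4 * ((wp y * wp y + wm y * wm y) * (S.om x₀ v₀ v₁ y * S.om x₀ v₂ v₃ y
        - S.om x₀ v₀ v₂ y * S.om x₀ v₁ v₃ y + S.om x₀ v₀ v₃ y * S.om x₀ v₁ v₂ y)) := by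
  rw [(d_reW_imW hE hcov hω hη hy v₀ v₁ v₂ v₃).2,
    (S.isComplexVolume y).wedge_eq_zero (S.isOrthComplex y) (finrank_tangentSpace hE y)
      (fun u => beta_J hE hcov hω hη u), Complex.zero_im]
  ring

end
end SpecialAlmostHermitian
end Geometry
end SU3

namespace SU3
open VectorField Filter Topology Module

/-! ### Constancy of α, the equations for dw₊ and dw₋, and closedness -/

section Geometry

namespace SpecialAlmostHermitian
open IsUnitaryFrame

variable {E : Type*} [NormedAddCommGroup E] [NormedSpace ℝ E] [FiniteDimensional ℝ E]
  {M : Type*} [TopologicalSpace M] [ChartedSpace E M] [IsManifold 𝓘(ℝ, E) ∞ M]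
  [RiemannianBundle (fun x : M => TangentSpace 𝓘(ℝ, E) x)]
  [IsContMDiffRiemannianBundle 𝓘(ℝ, E) ∞ E (fun x : M => TangentSpace 𝓘(ℝ, E) x)]
  {S : SpecialAlmostHermitian E M}
  {cov : CovariantDerivative 𝓘(ℝ, E) E (fun x : M => TangentSpace 𝓘(ℝ, E) x)}
  {wp wm : M → ℝ} {η : Π x : M, TangentSpace 𝓘(ℝ, E) x →L[ℝ] ℝ}
  (hE : finrank ℝ E = 6) (hcov : IsLeviCivita cov)
  (hω : ∀ x, S.NablaOmegaEqAt cov x (wp x) (wm x)) (hη : S.IsTorsionOneForm cov η)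

section
include hE hcov hω

theorem mdifferentiableAt_alpha (x : M) : MDifferentiableAt 𝓘(ℝ, E) 𝓘(ℝ, ℝ)
    (fun y => wp y * wp y + wm y * wm y) x :=
  (((S.contMDiffAt_coeff hE hcov hω x).1.mul (S.contMDiffAt_coeff hE hcov hω x).1).add
    ((S.contMDiffAt_coeff hE hcov hω x).2.mul
      (S.contMDiffAt_coeff hE hcov hω x).2)).mdifferentiableAt (by simp)

include hη

/-- A component of the derivative of `d Im (conj W Ψ) = 2 |W|² ω ∧ ω`. -/
theorem dirD_d_imW {x₀ y : M} (hy : y ∈ (extChartAt 𝓘(ℝ, E) x₀).source) (t a b c d : E) :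
    dirD x₀ t (dirD x₀ a (S.imW wp wm x₀ b c d)) y - dirD x₀ t (dirD x₀ b (S.imW wp wm x₀ a c d)) y
      + dirD x₀ t (dirD x₀ c (S.imW wp wm x₀ a b d)) y
      - dirD x₀ t (dirD x₀ d (S.imW wp wm x₀ a b c)) y =
    4 * ((wp y * wp y + wm y * wm y) *
      ((S.om x₀ a b y * dirD x₀ t (S.om x₀ c d) y + S.om x₀ c d y * dirD x₀ t (S.om x₀ a b) y)
      - (S.om x₀ a c y * dirD x₀ t (S.om x₀ b d) y + S.om x₀ b d y * dirD x₀ t (S.om x₀ a c) y)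
      + (S.om x₀ a d y * dirD x₀ t (S.om x₀ b c) y + S.om x₀ b c y * dirD x₀ t (S.om x₀ a d) y))
      + (S.om x₀ a b y * S.om x₀ c d y - S.om x₀ a c y * S.om x₀ b d y
        + S.om x₀ a d y * S.om x₀ b c y) *
        dirD x₀ t (fun z => wp z * wp z + wm z * wm z) y) := by
  have hL : ∀ p q r s : E, HasDirDeriv (dirD x₀ p (S.imW wp wm x₀ q r s)) y (chartField x₀ t y)
      (dirD x₀ t (dirD x₀ p (S.imW wp wm x₀ q r s)) y) := fun p q r s =>
    ((contMDiffAt_dirD hy p (contMDiffAt_imW hE hcov hω hy q r s)).mdifferentiableAt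
      (by simp)).hasDirDeriv _
  have hR : ∀ p q : E, HasDirDeriv (S.om x₀ p q) y (chartField x₀ t y)
      (dirD x₀ t (S.om x₀ p q) y) := fun p q =>
    ((S.contMDiffAt_om hy p q).mdifferentiableAt (by simp)).hasDirDeriv _
  have h1 := (((hL a b c d).sub (hL b a c d)).add (hL c a b d)).sub (hL d a b c)
  have h2 := ((mdifferentiableAt_alpha hE hcov hω y).hasDirDeriv (chartField x₀ t y)).mul
    ((((hR a b).mul (hR c d)).sub ((hR a c).mul (hR b d))).add ((hR a d).mul (hR b c)))
      |>.const_mul 4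
  refine h1.unique (h2.congr ?_)
  filter_upwards [(isOpen_extChartAt_source (I := 𝓘(ℝ, E)) x₀).mem_nhds hy] with z hz
  exact d_imW hE hcov hω hη hz a b c d

/-- Differentiating d Im(W̄Ψ) = 2α ω∧ω gives dα∧ω∧ω + 2α dω∧ω = 0. On (e₁, Je₁, e₂, Je₂, e₀) only
dα(e₀) survives, and every unit vector occurs as e₀ of a unitary frame. -/
theorem mvfderiv_alpha (x : M) : mvfderiv 𝓘(ℝ, E) (fun y => wp y * wp y + wm y * wm y) x = 0 := by
  suffices h : ∀ u : TangentSpace 𝓘(ℝ, E) x, inner ℝ u u = (1 : ℝ) →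
      mvfderiv 𝓘(ℝ, E) (fun y => wp y * wp y + wm y * wm y) x u = 0 by
    ext u
    rcases eq_or_ne u 0 with rfl | hu
    · simp
    have := h ((‖u‖⁻¹) • u) (by
      rw [real_inner_self_eq_norm_sq, norm_smul, norm_inv, norm_norm,
        inv_mul_cancel₀ (norm_ne_zero_iff.2 hu), one_pow])
    rw [map_smul, smul_eq_zero] at this
    simpa [hu] using this
  intro u hu
  have hJ := S.isOrthComplex x
  obtain ⟨e, he, rfl⟩ := hJ.exists_unitaryFrame (finrank_tangentSpace hE x) hu
  have hx := mem_extChartAt_source (I := 𝓘(ℝ, E)) x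
  have hs : ∀ u : TangentSpace 𝓘(ℝ, E) x, ∃ v : E, chartField x v x = u :=
    fun u => ⟨u, chartField_self x u⟩
  obtain ⟨v₀, h₀⟩ := hs (e 1)
  obtain ⟨v₁, h₁⟩ := hs (S.J x (e 1))
  obtain ⟨v₂, h₂⟩ := hs (e 2)
  obtain ⟨v₃, h₃⟩ := hs (S.J x (e 2))
  obtain ⟨v₄, h₄⟩ := hs (e 0)
  have ho : ∀ v w, S.om x v w x = inner ℝ (chartField x v x) (S.J x (chartField x w x)) :=
    fun _ _ => rfl
  have hee : ∀ i j, inner ℝ (e i) (e j) = if i = j then (1 : ℝ) else 0 := he.1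
  have heJ : ∀ i j, inner ℝ (e i) (S.J x (e j)) = (0 : ℝ) := he.2
  have w01 : S.om x v₀ v₁ x = -1 := by
    rw [ho, h₀, h₁, hJ.sq, inner_neg_right, hee, if_pos rfl]
  have w23 : S.om x v₂ v₃ x = -1 := by
    rw [ho, h₂, h₃, hJ.sq, inner_neg_right, hee, if_pos rfl]
  have w02 : S.om x v₀ v₂ x = 0 := by simp [ho, h₀, h₂, heJ]
  have w03 : S.om x v₀ v₃ x = 0 := by simp [ho, h₀, h₃, hJ.sq, hee]
  have w04 : S.om x v₀ v₄ x = 0 := by simp [ho, h₀, h₄, heJ]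
  have w12 : S.om x v₁ v₂ x = 0 := by simp [ho, h₁, h₂, hJ.orth, hee]
  have w13 : S.om x v₁ v₃ x = 0 := by simp [ho, h₁, h₃, hJ.orth, heJ]
  have w14 : S.om x v₁ v₄ x = 0 := by simp [ho, h₁, h₄, hJ.orth, hee]
  have w24 : S.om x v₂ v₄ x = 0 := by simp [ho, h₂, h₄, heJ]
  have w34 : S.om x v₃ v₄ x = 0 := by simp [ho, h₃, h₄, hJ.orth, hee]
  have hΨ := S.isComplexVolume x
  -- The only components of dω that enter contain a pair X, JX; they vanish because Ψ(X, JX, ·) =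
  -- iΨ(X, X, ·) = 0.
  have d1 := S.d_omega hx hcov (hω x) v₂ v₃ v₄
  have d2 := S.d_omega hx hcov (hω x) v₀ v₁ v₄
  simp only [re3, im3, h₀, h₁, h₂, h₃, h₄, hΨ.J_mid, alt_self01, mul_zero, Complex.zero_re,
    Complex.zero_im, add_zero] at d1 d2
  have H := dirD_d_imW hE hcov hω hη hx
  have H0 := H v₀ v₁ v₂ v₃ v₄
  have H1 := H v₁ v₀ v₂ v₃ v₄
  have H2 := H v₂ v₀ v₁ v₃ v₄
  have H3 := H v₃ v₀ v₁ v₂ v₄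
  have H4 := H v₄ v₀ v₁ v₂ v₃
  have hc := fun v w a b c => dirD_comm hx v w (contMDiffAt_imW hE hcov hω hx a b c)
  rw [hc v₁ v₀] at H1
  rw [hc v₂ v₀, hc v₂ v₁] at H2
  rw [hc v₃ v₀, hc v₃ v₁, hc v₃ v₂] at H3
  rw [hc v₄ v₀, hc v₄ v₁, hc v₄ v₂, hc v₄ v₃] at H4
  simp only [w01, w02, w03, w04, w12, w13, w14, w23, w24, w34] at H0 H1 H2 H3 H4
  -- The alternating sum of the five equations is d² = 0 on the left; on the right `d1` and `d2`
  -- remove the part proportional to α.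
  have hα : dirD x v₄ (fun z => wp z * wp z + wm z * wm z) x = 0 := by
    linear_combination (1 / 4) * (-H0 + H1 - H2 + H3 - H4) +
      (wp x * wp x + wm x * wm x) * (d1 + d2)
  rwa [dirD, h₄] at hα

/-- The form Wβ has real part ½dα = 0, and a (1,0)-form is determined by its real part, its
imaginary part at `t` being minus the real part at `J t`. Then W can be cancelled. -/
theorem beta_eq_zero (x : M) (hα : wp x * wp x + wm x * wm x ≠ 0) (t : TangentSpace 𝓘(ℝ, E) x) :
    S.beta wp wm η x t = 0 := by
  have h1 : ∀ u : TangentSpace 𝓘(ℝ, E) x,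
      ((wp x + wm x * Complex.I) * S.beta wp wm η x u).re = 0 := by
    intro u
    have hp := ((S.contMDiffAt_coeff hE hcov hω x).1.mdifferentiableAt (by simp)).hasDirDeriv u
    have hm := ((S.contMDiffAt_coeff hE hcov hω x).2.mdifferentiableAt (by simp)).hasDirDeriv u
    have h := ((hp.mul hp).add (hm.mul hm)).2
    rw [mvfderiv_alpha hE hcov hω hη] at h
    simp [beta] at h ⊢
    linear_combination -(1 / 2) * h
  have h2 := h1 (S.J x t)
  rw [beta_J hE hcov hω hη] at h2
  have h3 : (wp x + wm x * Complex.I) * S.beta wp wm η x t = 0 := by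
    refine Complex.ext (h1 t) ?_
    have : (wp x + wm x * Complex.I) * (Complex.I * S.beta wp wm η x t) =
      Complex.I * ((wp x + wm x * Complex.I) * S.beta wp wm η x t) := by ring
    rw [this, Complex.I_mul_re, neg_eq_zero] at h2
    exact h2
  refine (mul_eq_zero.1 h3).resolve_left fun h => hα ?_
  have hr := congrArg Complex.re h
  have hi := congrArg Complex.im h
  simp at hr hi
  simp [hr, hi]

/-- `dw₊ = -3 w₋ Iη` and `dw₋ = 3 w₊ Iη`. -/
theorem mvfderiv_coeff (x : M) (hα : wp x * wp x + wm x * wm x ≠ 0) :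
    mvfderiv 𝓘(ℝ, E) wp x = -((3 * wm x) • S.I η x) ∧
    mvfderiv 𝓘(ℝ, E) wm x = (3 * wp x) • S.I η x := by
  have h : ∀ t, mvfderiv 𝓘(ℝ, E) wp x t = -(3 * wm x * S.I η x t) ∧
      mvfderiv 𝓘(ℝ, E) wm x t = 3 * wp x * S.I η x t := by
    intro t
    have h0 := beta_eq_zero hE hcov hω hη x hα t
    have hr := congrArg Complex.re h0
    have hi := congrArg Complex.im h0
    simp [beta] at hr hi
    constructor
    · linear_combination hr
    · linear_combination -hi
  exact ⟨ContinuousLinearMap.ext fun t => (h t).1, ContinuousLinearMap.ext fun t => (h t).2⟩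

end

include hE in
/-- The coefficients of `∇ω` at a point are determined. -/
theorem NablaOmegaEqAt.unique {x : M} {a b a' b' : ℝ} (h : S.NablaOmegaEqAt cov x a b)
    (h' : S.NablaOmegaEqAt cov x a' b') : a = a' ∧ b = b' := by
  obtain ⟨e, he, hP⟩ := S.exists_frame hE x
  have hx := mem_extChartAt_source (I := 𝓘(ℝ, E)) x
  have key : ∀ u : TangentSpace 𝓘(ℝ, E) x, a * (S.Ψ x ![u, e 1, e 2]).re +
      b * (S.Ψ x ![u, e 1, e 2]).im = a' * (S.Ψ x ![u, e 1, e 2]).re +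
      b' * (S.Ψ x ![u, e 1, e 2]).im := by
    intro u
    have hd : ∀ i : Fin 2, DiffFieldAt
        ((![chartField x (e 1), chartField x (e 2)] :
          Fin 2 → Π y : M, TangentSpace 𝓘(ℝ, E) y) i) x := by
      intro i
      fin_cases i
      · exact (chartField_smooth x _ hx).diffFieldAt
      · exact (chartField_smooth x _ hx).diffFieldAt
    have := (h _ hd u).symm.trans (h' _ hd u)
    simp only [psiPlus, psiMinus, Matrix.cons_val_zero, Matrix.cons_val_one] at this
    rwa [chartField_self, chartField_self] at this
  have k1 := key (e 0)
  -- The second equation is the first with Ψ multiplied by i, so the system has determinant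
  -- |Ψ(e₀,e₁,e₂)|².
  have k2 := key (S.J x (e 0))
  rw [(S.isComplexVolume x).J_left] at k2
  simp only [Complex.mul_re, Complex.mul_im, Complex.I_re, Complex.I_im] at k2
  set z := S.Ψ x ![e 0, e 1, e 2]
  have hz : z.re * z.re + z.im * z.im ≠ 0 := by
    rw [← Complex.normSq_apply]
    exact fun h => hP (Complex.normSq_eq_zero.1 h)
  constructor
  · refine mul_right_cancel₀ hz ?_
    linear_combination z.re * k1 - z.im * k2
  · refine mul_right_cancel₀ hz ?_
    linear_combination z.im * k1 + z.re * k2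

theorem I_eq_zero_iff {x : M} : S.I η x = 0 ↔ η x = 0 := by
  constructor
  · intro h
    ext u
    have h1 := DFunLike.congr_fun h (S.J x u)
    simpa [I, S.J_sq] using h1
  · intro h
    simp [I, h]

/-- If `w₊² + w₋²` is a nonzero constant `c`, then `3 c θ = w₊ dw₋ - w₋ dw₊` is closed when `dw₊`
and `dw₋` are multiples of `θ`. -/
theorem isClosedOneForm_of_mvfderiv {θ : Π x : M, TangentSpace 𝓘(ℝ, E) x →L[ℝ] ℝ} {c : ℝ}
    (hc : c ≠ 0) (hα : ∀ x, wp x ^ 2 + wm x ^ 2 = c)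
    (hs : ∀ x, ContMDiffAt 𝓘(ℝ, E) 𝓘(ℝ, ℝ) ∞ wp x ∧ ContMDiffAt 𝓘(ℝ, E) 𝓘(ℝ, ℝ) ∞ wm x)
    (hp : ∀ x, mvfderiv 𝓘(ℝ, E) wp x = -((3 * wm x) • θ x))
    (hm : ∀ x, mvfderiv 𝓘(ℝ, E) wm x = (3 * wp x) • θ x) : IsClosedOneForm θ := by
  have hp' : ∀ (x : M) (u : TangentSpace 𝓘(ℝ, E) x),
      mvfderiv 𝓘(ℝ, E) wp x u = -(3 * wm x * θ x u) := fun x u => by rw [hp]; rfl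
  have hm' : ∀ (x : M) (u : TangentSpace 𝓘(ℝ, E) x),
      mvfderiv 𝓘(ℝ, E) wm x u = 3 * wp x * θ x u := fun x u => by rw [hm]; rfl
  have hθ : ∀ (x : M) (u : TangentSpace 𝓘(ℝ, E) x), θ x u =
      1 / (3 * c) * (wp x * mvfderiv 𝓘(ℝ, E) wm x u - wm x * mvfderiv 𝓘(ℝ, E) wp x u) := by
    intro x u
    rw [hp', hm']
    field_simp
    linear_combination -(θ x u) * hα x
  constructor
  · intro x V hV
    refine ContMDiffAt.congr_of_eventuallyEq ?_ (Eventually.of_forall fun y => hθ y (V 0 y))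
    exact contMDiffAt_const.mul (((hs x).1.mul (contMDiffAt_mvfderiv (hs x).2 (hV 0))).sub
      ((hs x).2.mul (contMDiffAt_mvfderiv (hs x).1 (hV 0))))
  · intro x X Y hX hY
    have key : ∀ (Z : Π y : M, TangentSpace 𝓘(ℝ, E) y), DiffFieldAt Z x →
        ∀ u : TangentSpace 𝓘(ℝ, E) x, mvfderiv 𝓘(ℝ, E) (fun y => θ y (Z y)) x u =
        1 / (3 * c) * ((wp x * mvfderiv 𝓘(ℝ, E) (fun y => mvfderiv 𝓘(ℝ, E) wm y (Z y)) x u +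
            mvfderiv 𝓘(ℝ, E) wm x (Z x) * mvfderiv 𝓘(ℝ, E) wp x u) -
          (wm x * mvfderiv 𝓘(ℝ, E) (fun y => mvfderiv 𝓘(ℝ, E) wp y (Z y)) x u +
            mvfderiv 𝓘(ℝ, E) wp x (Z x) * mvfderiv 𝓘(ℝ, E) wm x u)) := by
      intro Z hZ u
      have a1 := ((hs x).1.mdifferentiableAt (by simp)).hasDirDeriv u
      have a2 := ((hs x).2.mdifferentiableAt (by simp)).hasDirDeriv u
      have b1 := (mdifferentiableAt_mvfderiv (hs x).1 hZ).hasDirDeriv u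
      have b2 := (mdifferentiableAt_mvfderiv (hs x).2 hZ).hasDirDeriv u
      exact ((((a1.mul b2).sub (a2.mul b1)).const_mul (1 / (3 * c))).congr
        (Eventually.of_forall fun y => hθ y (Z y))).2
    have c1 := mvfderiv_mvfderiv_sub (hs x).1 hX hY
    have c2 := mvfderiv_mvfderiv_sub (hs x).2 hX hY
    -- The second derivatives cancel against the bracket term. What is left is a multiple of
    -- dw₊∧dw₋, which is zero since both factors are multiples of θ.
    rw [key Y hY, key X hX, hθ x (mlieBracket 𝓘(ℝ, E) X Y x), ← c1, ← c2, hp' x (X x), hp' x (Y x),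
      hm' x (X x), hm' x (Y x)]
    ring

end SpecialAlmostHermitian
end Geometry
end SU3

/-! ### The theorem -/

theorem theorem3p5
    {E : Type*} [NormedAddCommGroup E] [NormedSpace ℝ E] [FiniteDimensional ℝ E]
    (hE : Module.finrank ℝ E = 6)
    {M : Type*} [TopologicalSpace M] [T2Space M] [SecondCountableTopology M] [ConnectedSpace M]
    [ChartedSpace E M] [IsManifold 𝓘(ℝ, E) ∞ M]
    [RiemannianBundle (fun x : M => TangentSpace 𝓘(ℝ, E) x)]
    [IsContMDiffRiemannianBundle 𝓘(ℝ, E) ∞ E (fun x : M => TangentSpace 𝓘(ℝ, E) x)]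
    (cov : CovariantDerivative 𝓘(ℝ, E) E (fun x : M => TangentSpace 𝓘(ℝ, E) x))
    (hcov : SU3.IsLeviCivita cov)
    (S : SU3.SpecialAlmostHermitian E M)
    (η : Π x : M, TangentSpace 𝓘(ℝ, E) x →L[ℝ] ℝ)
    (hη : S.IsTorsionOneForm cov η)
    (wp wm : M → ℝ)
    (hω : ∀ x, S.NablaOmegaEqAt cov x (wp x) (wm x))
    (hW5 : ¬ S.IsTypeW5 cov) :
    -- `∇ω` vanishes nowhere, `α` is a positive constant, `dw₊ = -3 w₋ Iη`, `dw₋ = 3 w₊ Iη`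
    ((∀ x, ¬ S.NablaOmegaEqAt cov x 0 0) ∧
      (∃ α : ℝ, 0 < α ∧ ∀ x, wp x ^ 2 + wm x ^ 2 = α) ∧
      (∀ x, MDifferentiableAt 𝓘(ℝ, E) 𝓘(ℝ, ℝ) wp x ∧
        mvfderiv 𝓘(ℝ, E) wp x = -((3 * wm x) • S.I η x)) ∧
      (∀ x, MDifferentiableAt 𝓘(ℝ, E) 𝓘(ℝ, ℝ) wm x ∧
        mvfderiv 𝓘(ℝ, E) wm x = (3 * wp x) • S.I η x)) ∧
    -- `Iη` is closed and `3α Iη = w₊ dw₋ - w₋ dw₊`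
    (SU3.IsClosedOneForm (S.I η) ∧
      ∀ x, (3 * (wp x ^ 2 + wm x ^ 2)) • S.I η x =
        wp x • mvfderiv 𝓘(ℝ, E) wm x - wm x • mvfderiv 𝓘(ℝ, E) wp x) ∧
    -- type `W₁⁺ + W₁⁻` iff `w₊` and `w₋` are constant
    (S.IsTypeW1PlusW1Minus cov η ↔ (∃ c, ∀ x, wp x = c) ∧ (∃ c, ∀ x, wm x = c)) ∧
    -- type `W₁⁺ + W₅` forces type `W₁⁺` or type `W₅`
    (S.IsTypeW1PlusW5 cov → S.IsTypeW1Plus cov η ∨ S.IsTypeW5 cov) ∧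
    -- type `W₁⁻ + W₅` forces type `W₁⁻` or type `W₅`
    (S.IsTypeW1MinusW5 cov → S.IsTypeW1Minus cov η ∨ S.IsTypeW5 cov) := by
  have hs := S.contMDiffAt_coeff hE hcov hω
  have hcd := fun x => (hs x).1.mdifferentiableAt (by simp)
  have hmd := fun x => (hs x).2.mdifferentiableAt (by simp)
  obtain ⟨x₀⟩ := (inferInstance : Nonempty M)
  have hconst : ∀ x, wp x ^ 2 + wm x ^ 2 = wp x₀ ^ 2 + wm x₀ ^ 2 := fun x => by
    have := SU3.eq_of_mvfderiv_eq_zero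
      (SU3.SpecialAlmostHermitian.mdifferentiableAt_alpha hE hcov hω)
      (SU3.SpecialAlmostHermitian.mvfderiv_alpha hE hcov hω hη) x x₀
    linarith
  have hpos : 0 < wp x₀ ^ 2 + wm x₀ ^ 2 := by
    refine lt_of_le_of_ne (by positivity) fun h0 => hW5 fun x => ?_
    have h1 := (hconst x).trans h0.symm
    have h2 : wp x = 0 := by nlinarith [sq_nonneg (wp x), sq_nonneg (wm x)]
    have h3 : wm x = 0 := by nlinarith [sq_nonneg (wp x), sq_nonneg (wm x)]
    have := hω x
    rwa [h2, h3] at this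
  have hne : ∀ x, wp x * wp x + wm x * wm x ≠ 0 := fun x => by
    have := hconst x
    rw [← sq, ← sq, this]
    exact hpos.ne'
  have hd := fun x => SU3.SpecialAlmostHermitian.mvfderiv_coeff hE hcov hω hη x (hne x)
  -- Both differentials are multiples of Iη whose coefficients never vanish simultaneously.
  have hzero : ∀ x, (mvfderiv 𝓘(ℝ, E) wp x = 0 ∧ mvfderiv 𝓘(ℝ, E) wm x = 0) ↔ η x = 0 := by
    intro x
    rw [← SU3.SpecialAlmostHermitian.I_eq_zero_iff (S := S) (η := η), (hd x).1, (hd x).2]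
    constructor
    · rintro ⟨h1, h2⟩
      by_contra h
      simp only [neg_eq_zero, smul_eq_zero, h, mul_eq_zero, or_false, OfNat.ofNat_ne_zero,
        false_or] at h1 h2
      exact hne x (by simp [h1, h2])
    · intro h
      simp [h]
  have hdconst : ∀ (f : M → ℝ) (c : ℝ), (∀ x, f x = c) → ∀ x, mvfderiv 𝓘(ℝ, E) f x = 0 := by
    intro f c hf x
    rw [show f = fun _ => c from funext hf]
    exact mvfderiv_const c
  refine ⟨⟨fun x h => ?_, ⟨_, hpos, hconst⟩, fun x => ⟨hcd x, (hd x).1⟩, fun x => ⟨hmd x, (hd x).2⟩⟩,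
    ⟨SU3.SpecialAlmostHermitian.isClosedOneForm_of_mvfderiv hpos.ne' hconst hs
      (fun x => (hd x).1) (fun x => (hd x).2), fun x => ?_⟩, ⟨fun h => ?_, fun h => ?_⟩,
    fun h => ?_, fun h => ?_⟩
  · obtain ⟨h1, h2⟩ := (hω x).unique hE h
    exact hne x (by simp [h1, h2])
  · rw [(hd x).1, (hd x).2]
    module
  · have h0 := fun x => (hzero x).2 (h.2 x)
    exact ⟨⟨wp x₀, fun x => SU3.eq_of_mvfderiv_eq_zero hcd (fun y => (h0 y).1) x x₀⟩,
      ⟨wm x₀, fun x => SU3.eq_of_mvfderiv_eq_zero hmd (fun y => (h0 y).2) x x₀⟩⟩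
  · obtain ⟨⟨c, hc⟩, ⟨d, hd'⟩⟩ := h
    exact ⟨fun x => ⟨_, _, hω x⟩,
      fun x => (hzero x).1 ⟨hdconst wp c hc x, hdconst wm d hd' x⟩⟩
  -- Uniqueness of the coefficients gives w₋ = 0. Then dw₋ = 0 trivially, and dw₊ = -3 w₋ Iη = 0, so
  -- η = 0.
  · have hm0 : ∀ x, wm x = 0 := fun x => by
      obtain ⟨a, ha⟩ := h x
      exact ((hω x).unique hE ha).2
    refine Or.inl ⟨h, fun x => (hzero x).1 ⟨?_, hdconst wm 0 hm0 x⟩⟩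
    rw [(hd x).1, hm0]
    simp
  · have hp0 : ∀ x, wp x = 0 := fun x => by
      obtain ⟨a, ha⟩ := h x
      exact ((hω x).unique hE ha).1
    refine Or.inl ⟨h, fun x => (hzero x).1 ⟨hdconst wp 0 hp0 x, ?_⟩⟩
    rw [(hd x).2, hp0]
    simp
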